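/- Let $\mathfrak{spin}(3,1)_{\mathbb C}$ be the complex Lie algebra with generators $J_a,K_a$ ($a=0,1,2$) and relations $[J_a,J_b]=i\varepsilon_{abc}J_c$, $[J_a,K_b]=i\varepsilon_{abc}K_c$, $[K_a,K_b]=-i\varepsilon_{abc}J_c$ (with $\varepsilon_{012}=1$), let $J_\pm=J_1\pm iJ_2$, $K_\pm=K_1\pm iK_2$, and let $\mathcal C_1=\vec J\cdot\vec K$, $\mathcal C_2=\vec J\cdot\vec J-\vec K\cdot\vec K$ be its two Casimirs. Write $\mathcal M_j=\{-j,-j+1,\dots,j\}$ and $C_\pm(j,m)=\sqrt{j\mp m}\,\sqrt{j\pm m+1}$. For $\gamma\in\{\tfrac12,1,\tfrac32,\dots\}$ and $A=\pm1$, let $F^A_\gamma$ be the module with basis $|\mu\rangle$, $\mu\in\mathcal M_\gamma$, on which $J_0|\mu\rangle=\mu|\mu\rangle$, $J_\pm|\mu\rangle=C_\pm(\gamma,\mu)|\mu\pm1\rangle$ and $K_a=iA\,J_a$. For $\lambda\in\tfrac12\mathbb Z$ and $\rho\in\mathbb C$ put $$P^-(j)=\frac{\sqrt{j+\lambda}\sqrt{j-\lambda}\sqrt{j+\rho}\sqrt{j-\rho}}{j\sqrt{2j+1}\sqrt{2j-1}},\qquad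 P^+(j)=P^-(j+1),\qquad P(j)=\frac{i\lambda\rho}{j(j+1)}\ (j\neq0),\quad P(0)=0$$ (principal square roots). Let $V_{\lambda,\rho}$ be the space of finite linear combinations of basis vectors $|j,m\rangle$, $m\in\mathcal M_j$, where $j$ runs in integer steps from $|\lambda|$ up to the first value with $P^+(j)=0$, that value included, or over all of $|\lambda|+\mathbb N_0$ if there is no such value; the action is $J_0|j,m\rangle=m|j,m\rangle$, $J_\pm|j,m\rangle=C_\pm(j,m)|j,m\pm1\rangle$, $$K_0|j,m\rangle=P^+(j)\sqrt{j+m+1}\sqrt{j-m+1}\,|j+1,m\rangle+P(j)\,m\,|j,m\rangle+P^-(j)\sqrt{j+m}\sqrt{j-m}\,|j-1,m\rangle,$$ $$K_\pm|j,m\rangle=\mp P^+(j)\sqrt{j\pm m+1}\sqrt{j\pm m+2}\,|j+1,m\pm1\rangle+P(j)\,C_\pm(j,m)\,|j,m\pm1\rangle\pm P^-(j)\sqrt{j\mp m}\sqrt{j\mp m-1}\,|j-1,m\pm1\rangle,$$ where a vector whose label does not occur is read as $0$. Let the generators act on $F^A_\gamma\otimes V_{\lambda,\rho}$ by $X\mapsto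 X\otimes 1+1\otimes X$. **Proposition.** Let $\gamma\in\{\tfrac12,1,\tfrac32,\dots\}$, $A=\pm1$, $\lambda\in\tfrac12\mathbb Z$, $\rho\in\mathbb C$, and suppose that $V_{\lambda,\rho}$ is infinite-dimensional. If $\rho+A\lambda\in(-2\gamma,2\gamma)\cap\mathbb Z$, then the Casimirs are not diagonalisable on the product module $F^A_\gamma\otimes V_{\lambda,\rho}$: neither for $\mathcal C_1$ nor for $\mathcal C_2$ does $F^A_\gamma\otimes V_{\lambda,\rho}$ have a (Hamel) basis consisting of eigenvectors. -/

import Mathlib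

open scoped TensorProduct

noncomputable section

namespace Lorentz

/-! All square roots are principal complex square roots `Complex.sqrt`; on non-negative real numbers
these are the usual square roots. -/

/-- `x` is an element of `|l| + {0, 1, 2, …}`. -/
def InTower (l x : ℚ) : Prop := ∃ n : ℕ, x = |l| + n

/-- The set `M_j = {-j, -j + 1, …, j - 1, j}` of magnetic numbers. -/
def Mset (j : ℚ) : Set ℚ := {m | ∃ k : ℕ, m = -j + k ∧ m ≤ j}

/-- The ladder coefficients `C_s(j, m) = √(j - s m) √(j + s m + 1)`, with `s = ± 1`. -/
def ladder (s : ℤ) (j m : ℚ) : ℂ :=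
  Complex.sqrt ((j : ℂ) - s * m) * Complex.sqrt ((j : ℂ) + s * m + 1)

/-- The coefficient `P⁻_{l,r}(j)`. -/
def Pminus (l : ℚ) (r : ℂ) (j : ℚ) : ℂ :=
  Complex.sqrt ((j : ℂ) + l) * Complex.sqrt ((j : ℂ) - l) * Complex.sqrt ((j : ℂ) + r) * Complex.sqrt ((j : ℂ) - r) /
    ((j : ℂ) * Complex.sqrt (2 * (j : ℂ) + 1) * Complex.sqrt (2 * (j : ℂ) - 1))

/-- The coefficient `P⁺_{l,r}(j) = P⁻_{l,r}(j + 1)`. -/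
def Pplus (l : ℚ) (r : ℂ) (j : ℚ) : ℂ := Pminus l r (j + 1)

/-- The coefficient `P_{l,r}(j)`. -/
def Pzero (l : ℚ) (r : ℂ) (j : ℚ) : ℂ :=
  if j = 0 then 0 else Complex.I * l * r / ((j : ℂ) * ((j : ℂ) + 1))

/-! ### The irreducible admissible modules `V_{l,r}` -/

/-- The labels `(j, m)` of the basis of `V_{l,r}`: `j` runs in integer steps from `|l|` up to the
first value (if there is one) at which `P⁺_{l,r}` vanishes, that value included, and `m` runs
over `M_j`. -/
def labels (l : ℚ) (r : ℂ) : Set (ℚ × ℚ) :=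
  {p | InTower l p.1 ∧ (∀ i : ℚ, InTower l i → i < p.1 → Pplus l r i ≠ 0) ∧ p.2 ∈ Mset p.1}

/-- The module `V_{l,r}`: finite linear combinations of the vectors `|(l,r) j, m⟩`. -/
abbrev V (l : ℚ) (r : ℂ) : Type := labels l r →₀ ℂ

open Classical in
/-- The basis vector `|(l,r) j, m⟩`, understood as `0` when `(j, m)` is not a label. -/
def ket (l : ℚ) (r : ℂ) (j m : ℚ) : V l r :=
  if h : (j, m) ∈ labels l r then Finsupp.single ⟨(j, m), h⟩ 1 else 0

/-- The linear operator on `V_{l,r}` sending each basis vector `|(l,r) j, m⟩` to `f j m`. -/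
def opV (l : ℚ) (r : ℂ) (f : ℚ → ℚ → V l r) : Module.End ℂ (V l r) :=
  Finsupp.linearCombination ℂ fun p : labels l r => f p.1.1 p.1.2

/-- `J₀` on `V_{l,r}`. -/
def J0V (l : ℚ) (r : ℂ) : Module.End ℂ (V l r) :=
  opV l r fun j m => (m : ℂ) • ket l r j m

/-- `J_±` on `V_{l,r}` (the sign is `s = ± 1`). -/
def JpmV (l : ℚ) (r : ℂ) (s : ℤ) : Module.End ℂ (V l r) :=
  opV l r fun j m => ladder s j m • ket l r j (m + s)

/-- `K₀` on `V_{l,r}`. -/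
def K0V (l : ℚ) (r : ℂ) : Module.End ℂ (V l r) :=
  opV l r fun j m =>
    (Pplus l r j * Complex.sqrt ((j : ℂ) + m + 1) * Complex.sqrt ((j : ℂ) - m + 1)) • ket l r (j + 1) m
    + (Pzero l r j * m) • ket l r j m
    + (Pminus l r j * Complex.sqrt ((j : ℂ) + m) * Complex.sqrt ((j : ℂ) - m)) • ket l r (j - 1) m

/-- `K_±` on `V_{l,r}` (the sign is `s = ± 1`). -/
def KpmV (l : ℚ) (r : ℂ) (s : ℤ) : Module.End ℂ (V l r) :=
  opV l r fun j m =>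
    (-(s : ℂ) * Pplus l r j * Complex.sqrt ((j : ℂ) + s * m + 1) * Complex.sqrt ((j : ℂ) + s * m + 2)) •
        ket l r (j + 1) (m + s)
    + (Pzero l r j * ladder s j m) • ket l r j (m + s)
    + ((s : ℂ) * Pminus l r j * Complex.sqrt ((j : ℂ) - s * m) * Complex.sqrt ((j : ℂ) - s * m - 1)) •
        ket l r (j - 1) (m + s)

/-! ### The finite-dimensional modules `F^A_g` -/

/-- The space of `F^A_g`, with basis `|g_A, μ⟩`, `μ ∈ M_g`. The sign `A` only enters in the action
of the boosts. -/
abbrev F (g : ℚ) : Type := Mset g →₀ ℂ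

open Classical in
/-- The basis vector `|g_A, μ⟩`, understood as `0` when `μ ∉ M_g`. -/
def ketF (g μ : ℚ) : F g := if h : μ ∈ Mset g then Finsupp.single ⟨μ, h⟩ 1 else 0

/-- The linear operator on `F^A_g` sending each basis vector `|g_A, μ⟩` to `f μ`. -/
def opF (g : ℚ) (f : ℚ → F g) : Module.End ℂ (F g) :=
  Finsupp.linearCombination ℂ fun μ : Mset g => f μ.1

/-- `J₀` on `F^A_g`. -/
def J0F (g : ℚ) : Module.End ℂ (F g) := opF g fun μ => (μ : ℂ) • ketF g μ

/-- `J_±` on `F^A_g`. -/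
def JpmF (g : ℚ) (s : ℤ) : Module.End ℂ (F g) :=
  opF g fun μ => ladder s g μ • ketF g (μ + s)

/-- `K₀` on `F^A_g`. -/
def K0F (A : ℤ) (g : ℚ) : Module.End ℂ (F g) :=
  opF g fun μ => (Complex.I * A * μ) • ketF g μ

/-- `K_±` on `F^A_g`. -/
def KpmF (A : ℤ) (g : ℚ) (s : ℤ) : Module.End ℂ (F g) :=
  opF g fun μ => (Complex.I * A * ladder s g μ) • ketF g (μ + s)

/-! ### Generators, product module and Casimirs -/

/-- The triple `(X₀, X₁, X₂)` obtained from `X₀` and `X_± = X₁ ± i X₂`. -/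
def cartesian {W : Type*} [AddCommGroup W] [Module ℂ W] (X0 : Module.End ℂ W)
    (Xpm : ℤ → Module.End ℂ W) : Fin 3 → Module.End ℂ W :=
  ![X0, (1 / 2 : ℂ) • (Xpm 1 + Xpm (-1)), (1 / (2 * Complex.I) : ℂ) • (Xpm 1 - Xpm (-1))]

/-- The rotation generators `(J₀, J₁, J₂)` on `V_{l,r}`. -/
def JV (l : ℚ) (r : ℂ) : Fin 3 → Module.End ℂ (V l r) := cartesian (J0V l r) (JpmV l r)

/-- The boost generators `(K₀, K₁, K₂)` on `V_{l,r}`. -/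
def KV (l : ℚ) (r : ℂ) : Fin 3 → Module.End ℂ (V l r) := cartesian (K0V l r) (KpmV l r)

/-- The rotation generators `(J₀, J₁, J₂)` on `F^A_g`. -/
def JF (g : ℚ) : Fin 3 → Module.End ℂ (F g) := cartesian (J0F g) (JpmF g)

/-- The boost generators `(K₀, K₁, K₂)` on `F^A_g`. -/
def KF (A : ℤ) (g : ℚ) : Fin 3 → Module.End ℂ (F g) := cartesian (K0F A g) (KpmF A g)

/-- The action `X ⊗ 1 + 1 ⊗ X` of a Lie algebra element on a tensor product. -/
def onProduct {W W' : Type*} [AddCommGroup W] [Module ℂ W] [AddCommGroup W'] [Module ℂ W']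
    (X : Module.End ℂ W) (X' : Module.End ℂ W') : Module.End ℂ (W ⊗[ℂ] W') :=
  TensorProduct.map X LinearMap.id + TensorProduct.map LinearMap.id X'

/-- The rotation generators on `F^A_g ⊗ V_{l,r}`. -/
def Jprod (g l : ℚ) (r : ℂ) (a : Fin 3) : Module.End ℂ (F g ⊗[ℂ] V l r) :=
  onProduct (JF g a) (JV l r a)

/-- The boost generators on `F^A_g ⊗ V_{l,r}`. -/
def Kprod (A : ℤ) (g l : ℚ) (r : ℂ) (a : Fin 3) : Module.End ℂ (F g ⊗[ℂ] V l r) :=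
  onProduct (KF A g a) (KV l r a)

/-- The Casimir `C₁ = J · K`. -/
def casimir1 {W : Type*} [AddCommGroup W] [Module ℂ W] (J K : Fin 3 → Module.End ℂ W) :
    Module.End ℂ W := ∑ a, J a * K a

/-- The Casimir `C₂ = J² - K²`. -/
def casimir2 {W : Type*} [AddCommGroup W] [Module ℂ W] (J K : Fin 3 → Module.End ℂ W) :
    Module.End ℂ W := ∑ a, J a * J a - ∑ a, K a * K a

/-- The Casimir `C₁` on `F^A_g ⊗ V_{l,r}`. -/
def casimir1Prod (A : ℤ) (g l : ℚ) (r : ℂ) : Module.End ℂ (F g ⊗[ℂ] V l r) :=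
  casimir1 (W := F g ⊗[ℂ] V l r) (Jprod g l r) (Kprod A g l r)

/-- The Casimir `C₂` on `F^A_g ⊗ V_{l,r}`. -/
def casimir2Prod (A : ℤ) (g l : ℚ) (r : ℂ) : Module.End ℂ (F g ⊗[ℂ] V l r) :=
  casimir2 (W := F g ⊗[ℂ] V l r) (Jprod g l r) (Kprod A g l r)

/-- An operator is diagonalisable if the space has a (Hamel) basis of eigenvectors. -/
def IsDiagonalisable {W : Type*} [AddCommMonoid W] [Module ℂ W] (T : Module.End ℂ W) : Prop :=
  ∃ (S : Set W) (b : Module.Basis S ℂ W), ∀ v : S, ∃ c : ℂ, T (b v) = c • b v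

end Lorentz

end

/-! The complexified Lorentz algebra is a sum of two commuting copies of `sl₂`, the chiral halves
`(J ± iK) / 2`. Put `ε = -iA`. On `F^A_γ` one has `K = -εJ`, so only the half `N = (J + εK) / 2`
acts there, with spin `γ = n / 2`. Expanding the Casimirs on the product, both become affine
functions, with non-zero slope, of the single operator `T = 2 S · N`, where `S` acts on `F^A_γ` and
`N` on `V` (`casimir1_onProduct`, `casimir2_onProduct`). It remains to show that `T` is not
diagonalisable.

On `V` the quadratic Casimir of `N` is the scalar `(ν² - 1) / 4` with `ν = ρ + Aλ`. As for the
coupling of two angular momenta, every eigenvalue of `T` has the form `((ν + n - 2k)² - (n + 1)² -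
ν² + 1) / 4` with `0 ≤ k ≤ n` (`spinCoupling_eigenvalue_sqrt`). If `ν` is an integer with `|ν| < n`,
two of the numbers `ν + n - 2k` are distinct and opposite, so at most `n` eigenvalues are available
(`card_couplingEigenvalues_le`). A diagonalisable `T` would then be annihilated by a polynomial `q`
of degree `d ≤ n` with simple roots.

Realise spin `n / 2` on forms of degree `n` in `x, y` and apply `q(T)` to `xⁿ ⊗ v`. Only `S₋ ⊗ N₊`
increases the power of `y`, so the coefficient of `x^(n-d) y^d` is `n (n-1) ⋯ (n-d+1) N₊^d v`
(`prod_spinCoupling_highest`). For `v = |j, j⟩` with `j = |λ|` this is non-zero: `V` is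
infinite-dimensional, so `P⁺` never vanishes on the tower, and each `N₊` produces a non-zero
multiple of the next highest-weight vector (`pow_chiral_raise_ne_zero`). This is a contradiction.

That `V` satisfies the Lorentz relations with scalar Casimirs (`lorentzRelations_V`) is checked in a
model where `|j, m⟩` is a multiple of `x^(j+m) y^(j-m)`: the square roots depending on `m` disappear
and the relations become recursions for `P⁻` and `P`. -/

open scoped TensorProduct

noncomputable section

namespace Lorentz


/-! ### Coupling a spin to an `sl₂`-representation, and the spin-orbit operator -/

section SpinCoupling

variable {V : Type*} [AddCommGroup V] [Module ℂ V]

/-- The operators `N₀, N₊, N₋` satisfy the relations of `sl₂`, and the quadratic Casimir acts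
as `(ν² - 1) / 4`. -/
structure IsSl2Rep (N0 Np Nm : Module.End ℂ V) (ν : ℂ) : Prop where
  zero_pos : ∀ v, N0 (Np v) = Np (N0 v) + Np v
  zero_neg : ∀ v, N0 (Nm v) = Nm (N0 v) - Nm v
  pos_neg : ∀ v, Np (Nm v) = Nm (Np v) + (2 : ℂ) • N0 v
  casimir : ∀ v, N0 (N0 v) + N0 v + Nm (Np v) = ((ν ^ 2 - 1) / 4) • v

/-- Twice the scalar product of the spin `n / 2` generators with `(N₀, N_±)`. A vector of the product
is the sequence of coefficients of the monomials `x ^ (n - k) y ^ k`. -/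
def spinCoupling (N0 Np Nm : Module.End ℂ V) (n : ℂ) : Module.End ℂ (ℤ → V) where
  toFun u k := (n - 2 * k) • N0 (u k) + ((k : ℂ) + 1) • Nm (u (k + 1)) + (n - k + 1) • Np (u (k - 1))
  map_add' u v := by
    ext k
    simp only [Pi.add_apply, map_add]
    module
  map_smul' c u := by
    ext k
    simp only [Pi.smul_apply, map_smul, RingHom.id_apply]
    module

/-- The operator `2 σ · (L + N) + 1`, with `L` the spin `n / 2` generators. -/
def spinOrbit (N0 Np Nm : Module.End ℂ V) (n : ℂ) : Module.End ℂ ((ℤ → V) × (ℤ → V)) where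
  toFun u :=
    (fun k => (n - 2 * k + 1) • u.1 k + (2 : ℂ) • N0 (u.1 k) + (2 * (n - k + 1)) • u.2 (k - 1)
        + (2 : ℂ) • Nm (u.2 k),
      fun k => (2 * ((k : ℂ) + 1)) • u.1 (k + 1) + (2 : ℂ) • Np (u.1 k)
        - (n - 2 * k - 1) • u.2 k - (2 : ℂ) • N0 (u.2 k))
  map_add' u v := by
    ext k
    all_goals
      simp only [Prod.fst_add, Prod.snd_add, Pi.add_apply, map_add]
      module
  map_smul' c u := by
    ext k
    all_goals
      simp only [Prod.smul_fst, Prod.smul_snd, Pi.smul_apply, map_smul, RingHom.id_apply]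
      module

variable {N0 Np Nm : Module.End ℂ V} {ν : ℂ}

/-- With `M = L + N`, the Pauli identities give `(2 σ · M + 1)² = 4 M² + 1`, which no longer
involves `σ` and so acts on each component separately. Here `M²` is the coupling plus the scalars `n
(n + 2) / 4` and `(ν² - 1) / 4`. -/
lemma spinOrbit_spinOrbit (h : IsSl2Rep N0 Np Nm ν) (n : ℂ) (u : (ℤ → V) × (ℤ → V)) :
    spinOrbit N0 Np Nm n (spinOrbit N0 Np Nm n u) =
      ((4 : ℂ) • spinCoupling N0 Np Nm n u.1 + ((n + 1) ^ 2 + ν ^ 2 - 1) • u.1,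
        (4 : ℂ) • spinCoupling N0 Np Nm n u.2 + ((n + 1) ^ 2 + ν ^ 2 - 1) • u.2) := by
  ext k
  · have e := h.casimir (u.1 k)
    have e' : N0 (N0 (u.1 k)) = ((ν ^ 2 - 1) / 4) • u.1 k - N0 (u.1 k) - Nm (Np (u.1 k)) := by
      rw [← e]; abel
    simp only [spinOrbit, spinCoupling, LinearMap.coe_mk, AddHom.coe_mk, map_add, map_sub, map_smul,
      Pi.add_apply, Pi.smul_apply, h.zero_neg, e', add_sub_cancel_right, sub_add_cancel]
    push_cast
    module
  · have e := h.casimir (u.2 k)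
    have e' : N0 (N0 (u.2 k)) = ((ν ^ 2 - 1) / 4) • u.2 k - N0 (u.2 k) - Nm (Np (u.2 k)) := by
      rw [← e]; abel
    simp only [spinOrbit, spinCoupling, LinearMap.coe_mk, AddHom.coe_mk, map_add, map_sub, map_smul,
      Pi.add_apply, Pi.smul_apply, h.zero_pos, h.pos_neg, e', add_sub_cancel_right, sub_add_cancel]
    push_cast
    module

/-- The pair of partial derivatives of a homogeneous polynomial of degree `n`. -/
def gradient (n : ℂ) (u : ℤ → V) : (ℤ → V) × (ℤ → V) :=
  (fun k => (n - k) • u k, fun k => ((k : ℂ) + 1) • u (k + 1))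

/-- The gradient places spin `(n + 1) / 2` inside spin `n / 2` tensored with spin `1 / 2`. If `R` is
the spin-orbit operator, `(R + 1)² = 4 (M + σ/2)² + 1`, and on gradients `(M + σ/2)²` is the total
Casimir for spin `(n + 1) / 2`, known once the coupling eigenvalue `c` is known. -/
lemma spinOrbit_gradient (h : IsSl2Rep N0 Np Nm ν) (n c : ℂ) (u : ℤ → V)
    (hu : spinCoupling N0 Np Nm (n + 1) u = c • u) :
    spinOrbit N0 Np Nm n (spinOrbit N0 Np Nm n (gradient (n + 1) u))
        + (2 : ℂ) • spinOrbit N0 Np Nm n (gradient (n + 1) u) + gradient (n + 1) u =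
      (4 * c + (n + 2) ^ 2 + ν ^ 2 - 1) • gradient (n + 1) u := by
  rw [spinOrbit_spinOrbit h]
  ext k
  · have e := congrFun hu k
    simp only [spinCoupling, LinearMap.coe_mk, AddHom.coe_mk, Pi.smul_apply] at e
    have e' : (4 * c * (n + 1 - k)) • u k = (4 * (n + 1 - k)) • (c • u k) := by module
    simp only [spinOrbit, spinCoupling, gradient, LinearMap.coe_mk, AddHom.coe_mk, map_smul,
      Pi.add_apply, Pi.smul_apply, Prod.fst_add, Prod.smul_fst, sub_add_cancel]
    rw [show ((4 * c + (n + 2) ^ 2 + ν ^ 2 - 1) • (n + 1 - (k : ℂ)) • u k) =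
      (4 * c * (n + 1 - k)) • u k + (((n + 2) ^ 2 + ν ^ 2 - 1) * (n + 1 - k)) • u k by module, e', ← e]
    push_cast
    module
  · have e := congrFun hu (k + 1)
    simp only [spinCoupling, LinearMap.coe_mk, AddHom.coe_mk, Pi.smul_apply,
      add_sub_cancel_right] at e
    have e' : (4 * c * (k + 1)) • u (k + 1) = (4 * ((k : ℂ) + 1)) • (c • u (k + 1)) := by module
    simp only [spinOrbit, spinCoupling, gradient, LinearMap.coe_mk, AddHom.coe_mk, map_smul,
      Pi.add_apply, Pi.smul_apply, Prod.snd_add, Prod.smul_snd, sub_add_cancel]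
    rw [show ((4 * c + (n + 2) ^ 2 + ν ^ 2 - 1) • ((k : ℂ) + 1) • u (k + 1)) =
      (4 * c * (k + 1)) • u (k + 1) + (((n + 2) ^ 2 + ν ^ 2 - 1) * (k + 1)) • u (k + 1) by module, e', ← e]
    push_cast
    module

end SpinCoupling


/-! ### Eigenvalues of the coupling and the criterion for non-diagonalisability -/

section SpinCouplingSpectrum

variable {V : Type*} [AddCommGroup V] [Module ℂ V]

/-- `u` vanishes outside `{0, …, n}`. -/
def SupportedUpTo (n : ℕ) (u : ℤ → V) : Prop := ∀ k : ℤ, k < 0 ∨ (n : ℤ) < k → u k = 0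

lemma gradient_supported {n : ℕ} {u : ℤ → V} (hu : SupportedUpTo (n + 1) u) :
    SupportedUpTo n (gradient ((n : ℂ) + 1) u).1 ∧ SupportedUpTo n (gradient ((n : ℂ) + 1) u).2 := by
  constructor
  · intro k hk
    by_cases h : k = n + 1
    · simp [gradient, h]
    · simp only [gradient]
      rw [hu k (by push_cast; omega), smul_zero]
  · intro k hk
    by_cases h : k = -1
    · simp [gradient, h]
    · simp only [gradient]
      rw [hu (k + 1) (by push_cast; omega), smul_zero]

/-- A form of positive degree with vanishing partial derivatives is zero: the factor `n + 1 - k` of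
the `x`-derivative vanishes only at `k = n + 1`, where the `y`-derivative has the factor `n + 1`. -/
lemma gradient_ne_zero {n : ℕ} {u : ℤ → V} (h0 : u ≠ 0) :
    gradient ((n : ℂ) + 1) u ≠ 0 := by
  intro h
  apply h0
  have h1 : ∀ k, ((n : ℂ) + 1 - (k : ℤ)) • u k = 0 := fun k => congrFun (congrArg Prod.fst h) k
  have h2 : ∀ k : ℤ, ((k : ℂ) + 1) • u (k + 1) = 0 := fun k => congrFun (congrArg Prod.snd h) k
  ext k
  by_cases hk : k = n + 1
  · have := h2 n
    rw [smul_eq_zero] at this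
    rcases this with h | h
    · exact absurd h (by exact_mod_cast Nat.succ_ne_zero n)
    · rw [hk, h]; rfl
  · have := h1 k
    rw [smul_eq_zero] at this
    rcases this with h | h
    · refine absurd ?_ hk
      have : (k : ℂ) = ((n + 1 : ℤ) : ℂ) := by push_cast; linear_combination -h
      exact_mod_cast this
    · exact h

variable {N0 Np Nm : Module.End ℂ V} {ν : ℂ}

lemma spinOrbit_supported {n : ℕ} {u : (ℤ → V) × (ℤ → V)} (h1 : SupportedUpTo n u.1)
    (h2 : SupportedUpTo n u.2) :
    SupportedUpTo n (spinOrbit N0 Np Nm n u).1 ∧ SupportedUpTo n (spinOrbit N0 Np Nm n u).2 := by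
  constructor
  · intro k hk
    simp only [spinOrbit, LinearMap.coe_mk, AddHom.coe_mk, h1 k hk, h2 k hk, map_zero, smul_zero,
      zero_add, add_zero]
    by_cases h : k = n + 1
    · simp [h]
    · rw [h2 (k - 1) (by omega), smul_zero]
  · intro k hk
    simp only [spinOrbit, LinearMap.coe_mk, AddHom.coe_mk, h1 k hk, h2 k hk, map_zero, smul_zero,
      add_zero, sub_zero]
    by_cases h : k = -1
    · simp [h]
    · rw [h1 (k + 1) (by omega), smul_zero]

/-- An eigenvector of `spinOrbit` yields one of `spinCoupling`. -/
lemma exists_spinCoupling_eigenvector_of_spinOrbit (h : IsSl2Rep N0 Np Nm ν) {n : ℕ} {r : ℂ}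
    {u : (ℤ → V) × (ℤ → V)} (h0 : u ≠ 0) (h1 : SupportedUpTo n u.1) (h2 : SupportedUpTo n u.2)
    (hu : spinOrbit N0 Np Nm n u = r • u) :
    ∃ w : ℤ → V, w ≠ 0 ∧ SupportedUpTo n w ∧
      spinCoupling N0 Np Nm n w = ((r ^ 2 - (n + 1) ^ 2 - ν ^ 2 + 1) / 4) • w := by
  have e := spinOrbit_spinOrbit h (n : ℂ) u
  rw [hu, map_smul, hu] at e
  have key : ∀ w : ℤ → V, r • r • w =
      (4 : ℂ) • spinCoupling N0 Np Nm n w + (((n : ℂ) + 1) ^ 2 + ν ^ 2 - 1) • w →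
      spinCoupling N0 Np Nm n w = ((r ^ 2 - (n + 1) ^ 2 - ν ^ 2 + 1) / 4) • w := by
    intro w hw
    have : spinCoupling N0 Np Nm n w = (1 / 4 : ℂ) • (r • r • w)
        - ((((n : ℂ) + 1) ^ 2 + ν ^ 2 - 1) / 4) • w := by
      rw [hw]; module
    rw [this]; module
  -- The square of the spin-orbit operator does not mix the components, so any non-zero component is
  -- an eigenvector of the coupling.
  by_cases hz : u.1 = 0
  · refine ⟨u.2, fun hz' => h0 (Prod.ext hz hz'), h2, key _ (congrArg Prod.snd e)⟩
  · exact ⟨u.1, hz, h1, key _ (congrArg Prod.fst e)⟩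

lemma SupportedUpTo.add_smul {n : ℕ} {u w : ℤ → V} (hu : SupportedUpTo n u)
    (hw : SupportedUpTo n w) (c : ℂ) : SupportedUpTo n (u + c • w) := fun k hk => by
  rw [Pi.add_apply, Pi.smul_apply, hu k hk, hw k hk, smul_zero, add_zero]

/-- The number `κ` plays the role of `2j + 1` for the total spin. Lowering the coupled spin by `1 /
2` changes it by one, up to sign; this drives the induction on `n`. -/
lemma exists_spinCoupling_eigenvector_pred (h : IsSl2Rep N0 Np Nm ν) {n : ℕ} {κ : ℂ}
    {u : ℤ → V} (h0 : u ≠ 0) (hs : SupportedUpTo (n + 1) u)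
    (hu : spinCoupling N0 Np Nm ((n : ℂ) + 1) u =
      ((κ ^ 2 - (n + 2) ^ 2 - ν ^ 2 + 1) / 4) • u) :
    ∃ κ' : ℂ, (κ' = κ - 1 ∨ κ' = κ + 1) ∧ ∃ w : ℤ → V, w ≠ 0 ∧ SupportedUpTo n w ∧
      spinCoupling N0 Np Nm n w = ((κ' ^ 2 - (n + 1) ^ 2 - ν ^ 2 + 1) / 4) • w := by
  have e := spinOrbit_gradient h _ _ u hu
  obtain ⟨s1, s2⟩ := gradient_supported hs
  have hg := gradient_ne_zero (n := n) h0
  set g := gradient ((n : ℂ) + 1) u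
  set R := spinOrbit N0 Np Nm (n : ℂ)
  rw [show 4 * ((κ ^ 2 - ((n : ℂ) + 2) ^ 2 - ν ^ 2 + 1) / 4) + (n + 2) ^ 2 + ν ^ 2 - 1 = κ ^ 2 by
    ring] at e
  -- The relation `(R + 1)² g = κ² g` factors: either `g` itself has eigenvalue `κ - 1`, or `(R + 1
  -- - κ) g` is non-zero and has eigenvalue `-(κ + 1)`. Only the square of the eigenvalue matters
  -- afterwards.
  by_cases hz : R g = (κ - 1) • g
  · exact ⟨κ - 1, Or.inl rfl, exists_spinCoupling_eigenvector_of_spinOrbit h hg s1 s2 hz⟩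
  · obtain ⟨t1, t2⟩ := spinOrbit_supported (N0 := N0) (Np := Np) (Nm := Nm) s1 s2
    have hv : R (R g + (1 - κ) • g) = (-(κ + 1)) • (R g + (1 - κ) • g) := by
      rw [map_add, map_smul]
      have : R (R g) = κ ^ 2 • g - (2 : ℂ) • R g - g := by rw [← e]; abel
      rw [this]; module
    obtain ⟨w, w0, ws, hw⟩ := exists_spinCoupling_eigenvector_of_spinOrbit h (n := n)
      (u := R g + (1 - κ) • g)
      (fun hh => hz (by
        have : R g = (R g + (1 - κ) • g) + (κ - 1) • g := by module
        rw [this, hh, zero_add]))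
      (t1.add_smul s1 _) (t2.add_smul s2 _) hv
    exact ⟨κ + 1, Or.inr rfl, w, w0, ws, by rw [hw]; congr 1; ring⟩

/-- No decomposition of the product into irreducible parts is used, so the bound holds for every
`sl₂`-representation with this scalar Casimir, in particular without any weight hypothesis. -/
lemma spinCoupling_eigenvalue_sqrt (h : IsSl2Rep N0 Np Nm ν) (n : ℕ) :
    ∀ (κ : ℂ) (u : ℤ → V), u ≠ 0 → SupportedUpTo n u →
      spinCoupling N0 Np Nm n u = ((κ ^ 2 - (n + 1) ^ 2 - ν ^ 2 + 1) / 4) • u →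
      ∃ k : ℕ, k ≤ n ∧ κ ^ 2 = (ν + n - 2 * k) ^ 2 := by
  induction n with
  | zero =>
    intro κ u h0 hs hu
    refine ⟨0, le_rfl, ?_⟩
    have hk : u 0 ≠ 0 := by
      intro hk
      apply h0
      ext k
      rcases lt_trichotomy k 0 with h | h | h
      · exact hs k (Or.inl h)
      · rw [h, hk]; rfl
      · exact hs k (Or.inr (by exact_mod_cast h))
    have e := congrFun hu 0
    simp only [spinCoupling, LinearMap.coe_mk, AddHom.coe_mk, Pi.smul_apply] at e
    rw [hs (0 + 1) (by simp), hs (0 - 1) (by simp)] at e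
    simp only [Nat.cast_zero, Int.cast_zero, mul_zero, sub_zero, zero_smul, map_zero, smul_zero,
      add_zero] at e
    rcases smul_eq_zero.1 e.symm with h | h
    · push_cast
      linear_combination 4 * h
    · exact absurd h hk
  | succ n ih =>
    intro κ u h0 hs hu
    push_cast at hu
    rw [show ((n : ℂ) + 1 + 1) = n + 2 by ring] at hu
    obtain ⟨κ', hκ, w, w0, ws, hw⟩ := exists_spinCoupling_eigenvector_pred h h0 hs hu
    obtain ⟨k, hk, e⟩ := ih κ' w w0 ws hw
    have e' : (κ' - (ν + n - 2 * k)) * (κ' + (ν + n - 2 * k)) = 0 := by linear_combination e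
    push_cast
    -- Since `κ' = ±(ν + n - 2k)` and `κ = κ' ± 1`, up to sign `κ` is `ν + (n + 1) - 2k` or `ν + (n
    -- + 1) - 2(k + 1)`.
    rcases mul_eq_zero.1 e' with e | e <;> rcases hκ with rfl | rfl
    · refine ⟨k, by omega, ?_⟩
      rw [show κ = ν + n - 2 * k + 1 by linear_combination e]; ring
    · refine ⟨k + 1, by omega, ?_⟩
      rw [show κ = ν + n - 2 * k - 1 by linear_combination e]; push_cast; ring
    · refine ⟨k + 1, by omega, ?_⟩
      rw [show κ = -(ν + n - 2 * k - 1) by linear_combination e]; push_cast; ring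
    · refine ⟨k, by omega, ?_⟩
      rw [show κ = -(ν + n - 2 * k + 1) by linear_combination e]; ring

/-- The possible eigenvalues of `spinCoupling`. -/
def couplingEigenvalues (ν : ℂ) (n : ℕ) : Finset ℂ :=
  (Finset.range (n + 1)).image fun k : ℕ => ((ν + n - 2 * k) ^ 2 - (n + 1) ^ 2 - ν ^ 2 + 1) / 4

lemma spinCoupling_eigenvalue_mem (h : IsSl2Rep N0 Np Nm ν) {n : ℕ} {c : ℂ} {u : ℤ → V}
    (h0 : u ≠ 0) (hs : SupportedUpTo n u) (hu : spinCoupling N0 Np Nm n u = c • u) :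
    c ∈ couplingEigenvalues ν n := by
  obtain ⟨κ, hκ⟩ := IsAlgClosed.exists_pow_nat_eq (4 * c + (n + 1) ^ 2 + ν ^ 2 - 1) (n := 2) (by norm_num)
  obtain ⟨k, hk, e⟩ := spinCoupling_eigenvalue_sqrt h n κ u h0 hs (by
    rw [hu, hκ]; congr 1; ring)
  rw [couplingEigenvalues, Finset.mem_image]
  refine ⟨k, Finset.mem_range.2 (by omega), ?_⟩
  rw [← e, hκ]; ring

lemma card_couplingEigenvalues_le {n : ℕ} {m : ℤ} (h1 : -(n : ℤ) < m) (h2 : m < n) :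
    (couplingEigenvalues m n).card ≤ n := by
  have : ¬ Set.InjOn (fun k : ℕ => (((m : ℂ) + n - 2 * k) ^ 2 - (n + 1) ^ 2 - (m : ℂ) ^ 2 + 1) / 4)
      (Finset.range (n + 1)) := by
    intro hinj
    -- The numbers `m + n - 2k` and `m + n - 2k'` are opposite exactly when `k + k' = n + m`. The
    -- bounds on `m` leave room for a solution with `k ≠ k'` in `{0, …, n}`.
    obtain ⟨k, k', hk, hk', hne, hsum⟩ : ∃ k k' : ℕ, k ≤ n ∧ k' ≤ n ∧ k ≠ k' ∧
        (k : ℤ) + k' = n + m := by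
      rcases le_total m 0 with hm | hm
      · exact ⟨0, (n + m).toNat, by omega, by omega, by omega, by omega⟩
      · exact ⟨n, m.toNat, by omega, by omega, by omega, by omega⟩
    refine hne (hinj (by simp; omega) (by simp; omega) ?_)
    have : (k : ℂ) + k' = n + m := by exact_mod_cast hsum
    dsimp only
    linear_combination (((m : ℂ) + n - 2 * k) - (m + n - 2 * k')) / 4 * (-2) * this
  have hlt := lt_of_le_of_ne (Finset.card_image_le (s := Finset.range (n + 1))
    (f := fun k : ℕ => (((m : ℂ) + n - 2 * k) ^ 2 - (n + 1) ^ 2 - (m : ℂ) ^ 2 + 1) / 4))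
    (fun hh => this (Finset.card_image_iff.1 hh))
  rw [Finset.card_range] at hlt
  exact Nat.lt_succ_iff.1 hlt

open Polynomial in
/-- On a vector concentrated in the highest power of `x`, a product of fewer than `n + 1` factors
`spinCoupling - c` has leading term a multiple of a power of `N₊`. -/
lemma prod_spinCoupling_highest {n : ℕ} {u : ℤ → V} (hs : ∀ k ≠ 0, u k = 0) (S : Finset ℂ) :
    (∀ k : ℤ, (S.card : ℤ) < k → aeval (spinCoupling N0 Np Nm n) (∏ c ∈ S, (X - C c)) u k = 0) ∧
    aeval (spinCoupling N0 Np Nm n) (∏ c ∈ S, (X - C c)) u S.card =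
      (∏ i ∈ Finset.range S.card, ((n : ℂ) - i)) • (Np ^ S.card) (u 0) := by
  induction S using Finset.induction_on with
  | empty =>
    simp only [Finset.card_empty, Finset.prod_empty, map_one, Module.End.one_apply]
    refine ⟨fun k hk => hs k (by rintro rfl; simp at hk), by simp⟩
  | insert a S ha ih =>
    rw [Finset.prod_insert ha, Finset.card_insert_of_notMem ha, map_mul, Module.End.mul_apply]
    obtain ⟨i1, i2⟩ := ih
    set w := aeval (spinCoupling N0 Np Nm (n : ℂ)) (∏ c ∈ S, (X - C c)) u
    have hw : ∀ k, aeval (spinCoupling N0 Np Nm (n : ℂ)) (X - C a) w k =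
        spinCoupling N0 Np Nm (n : ℂ) w k - a • w k := by
      intro k
      simp [Module.algebraMap_end_apply]
    constructor
    · intro k hk
      push_cast at hk
      rw [hw, i1 k (by omega)]
      simp only [spinCoupling, LinearMap.coe_mk, AddHom.coe_mk]
      rw [i1 k (by omega), i1 (k + 1) (by omega), i1 (k - 1) (by omega)]
      simp
    · rw [hw]
      simp only [spinCoupling, LinearMap.coe_mk, AddHom.coe_mk]
      -- At the new top index only the `N₊` term survives, and its coefficient `n - k + 1` at `k =
      -- S.card + 1` is the next factor `n - S.card`.
      rw [i1 _ (by push_cast; omega), i1 _ (by push_cast; omega),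
        show (((S.card + 1 : ℕ) : ℤ) - 1) = S.card by push_cast; ring, i2, Finset.prod_range_succ,
        pow_succ', Module.End.mul_apply]
      simp only [map_zero, smul_zero, zero_add, sub_zero, map_smul]
      push_cast
      module

/-- Non-diagonalisability criterion. -/
lemma not_isDiagonalisable_of_spinCoupling {W : Type*} [AddCommGroup W] [Module ℂ W]
    {n : ℕ} {m : ℤ} (h : IsSl2Rep N0 Np Nm (m : ℂ)) (h1 : -(n : ℤ) < m) (h2 : m < n)
    {v : V} (hv : ∀ d : ℕ, (Np ^ d) v ≠ 0)
    (T : Module.End ℂ W) (Θ : W →ₗ[ℂ] (ℤ → V)) (hinj : Function.Injective Θ)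
    (hΘ : ∀ w, SupportedUpTo n (Θ w)) (hT : ∀ w, Θ (T w) = spinCoupling N0 Np Nm n (Θ w))
    (w : W) (hw0 : Θ w 0 = v) (hw : ∀ k ≠ 0, Θ w k = 0) : ¬ IsDiagonalisable T := by
  rintro ⟨s, b, hb⟩
  open Polynomial in
  set q : ℂ[X] := ∏ c ∈ couplingEigenvalues (m : ℂ) n, (X - C c)
  -- Each basis vector is an eigenvector whose eigenvalue is a root of `q`.
  have hq : Polynomial.aeval T q = 0 := by
    refine b.ext fun i => ?_
    obtain ⟨c, hc⟩ := hb i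
    have hmem : c ∈ couplingEigenvalues (m : ℂ) n := by
      refine spinCoupling_eigenvalue_mem h (u := Θ (b i)) ?_ (hΘ _) (by rw [← hT, hc, map_smul])
      exact fun h0 => b.ne_zero i (hinj (by rw [h0, map_zero]))
    rw [Module.End.aeval_apply_of_hasEigenvector (μ := c)
      ⟨Module.End.mem_eigenspace_iff.2 hc, b.ne_zero i⟩]
    rw [Polynomial.eval_prod, Finset.prod_eq_zero hmem (by simp)]
    simp
  have hΘq : ∀ (p : Polynomial ℂ) (w : W),
      Θ (Polynomial.aeval T p w) = Polynomial.aeval (spinCoupling N0 Np Nm (n : ℂ)) p (Θ w) := by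
    intro p
    induction p using Polynomial.induction_on' with
    | add p q hp hq => intro w; simp [hp, hq]
    | monomial k a =>
      intro w
      have : ∀ w, Θ ((T ^ k) w) = (spinCoupling N0 Np Nm (n : ℂ) ^ k) (Θ w) := by
        induction k with
        | zero => simp
        | succ k ih => intro w; rw [pow_succ, Module.End.mul_apply, ih, hT, pow_succ, Module.End.mul_apply]
      simp [Polynomial.aeval_monomial, Module.algebraMap_end_apply, this]
  have e := (prod_spinCoupling_highest (N0 := N0) (Np := Np) (Nm := Nm) (n := n) hw
    (couplingEigenvalues (m : ℂ) n)).2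
  rw [← hΘq, hq, hw0] at e
  have e0 := e.symm
  rw [LinearMap.zero_apply, map_zero, Pi.zero_apply, smul_eq_zero] at e0
  rcases e0 with e0 | e0
  · rw [Finset.prod_eq_zero_iff] at e0
    obtain ⟨i, hi, hi0⟩ := e0
    have hlt := lt_of_lt_of_le (Finset.mem_range.1 hi) (card_couplingEigenvalues_le h1 h2)
    have : (n : ℂ) = i := by linear_combination hi0
    have : n = i := by exact_mod_cast this
    omega
  · exact hv _ e0

end SpinCouplingSpectrum


/-! ### The Lorentz relations on monomials -/

section MonomialModel

/-- The relations of the Lorentz algebra in terms of `J₀, J_±, K₀, K_±`, with Casimirs acting as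
the scalars `c₁`, `c₂`, applied to the vector `v`. -/
structure LorentzRelations {W : Type*} [AddCommGroup W] [Module ℂ W]
    (J0 Jp Jm K0 Kp Km : Module.End ℂ W) (c₁ c₂ : ℂ) (v : W) : Prop where
  j0_jp : J0 (Jp v) = Jp (J0 v) + Jp v
  j0_jm : J0 (Jm v) = Jm (J0 v) - Jm v
  jp_jm : Jp (Jm v) = Jm (Jp v) + (2 : ℂ) • J0 v
  j0_k0 : J0 (K0 v) = K0 (J0 v)
  j0_kp : J0 (Kp v) = Kp (J0 v) + Kp v
  j0_km : J0 (Km v) = Km (J0 v) - Km v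
  k0_jp : K0 (Jp v) = Jp (K0 v) + Kp v
  k0_jm : K0 (Jm v) = Jm (K0 v) - Km v
  jp_km : Jp (Km v) = Km (Jp v) + (2 : ℂ) • K0 v
  kp_jm : Kp (Jm v) = Jm (Kp v) + (2 : ℂ) • K0 v
  k0_kp : K0 (Kp v) = Kp (K0 v) - Jp v
  k0_km : K0 (Km v) = Km (K0 v) + Jm v
  kp_km : Kp (Km v) = Km (Kp v) - (2 : ℂ) • J0 v
  casimir₁ : J0 (K0 v) + K0 v + (1 / 2 : ℂ) • (Jm (Kp v) + Km (Jp v)) = c₁ • v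
  casimir₂ : J0 (J0 v) + (2 : ℂ) • J0 v + Jm (Jp v) - K0 (K0 v) - Km (Kp v) = c₂ • v

/-- The space spanned by the symbols `monomial n a`, thought of as `x ^ a y ^ (n - a)`. -/
abbrev MonomialSpace : Type := ℤ × ℤ →₀ ℂ

/-- The basis vector `x ^ a y ^ (n - a)`. -/
def mono (n a : ℤ) : MonomialSpace := Finsupp.single (n, a) 1

/-- The linear operator with prescribed values on monomials. -/
def monoOp (f : ℤ → ℤ → MonomialSpace) : Module.End ℂ MonomialSpace :=
  Finsupp.linearCombination ℂ fun p : ℤ × ℤ => f p.1 p.2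

@[simp] lemma monoOp_mono (f : ℤ → ℤ → MonomialSpace) (n a : ℤ) : monoOp f (mono n a) = f n a := by
  simp [monoOp, mono]

/-- `J₀` on monomials. -/
def monoJ0 : Module.End ℂ MonomialSpace := monoOp fun n a => ((a : ℂ) - n / 2) • mono n a

/-- `J₊` on monomials. -/
def monoJp : Module.End ℂ MonomialSpace := monoOp fun n a => ((n : ℂ) - a) • mono n (a + 1)

/-- `J₋` on monomials. -/
def monoJm : Module.End ℂ MonomialSpace := monoOp fun n a => (a : ℂ) • mono n (a - 1)

/-- `K₀` on monomials. -/
def monoK0 (p q : ℤ → ℂ) : Module.End ℂ MonomialSpace := monoOp fun n a =>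
  p (n + 2) • mono (n + 2) (a + 1) + (q n * (a - n / 2)) • mono n a
    + (p n * (a * (n - a))) • mono (n - 2) (a - 1)

/-- `K₊` on monomials. -/
def monoKp (p q : ℤ → ℂ) : Module.End ℂ MonomialSpace := monoOp fun n a =>
  (-p (n + 2)) • mono (n + 2) (a + 2) + (q n * (n - a)) • mono n (a + 1)
    + (p n * ((n - a) * (n - a - 1))) • mono (n - 2) a

/-- `K₋` on monomials. -/
def monoKm (p q : ℤ → ℂ) : Module.End ℂ MonomialSpace := monoOp fun n a =>
  p (n + 2) • mono (n + 2) a + (q n * a) • mono n (a - 1)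
    + (-(p n * (a * (a - 1)))) • mono (n - 2) (a - 2)

set_option linter.unusedSimpArgs false in
/-- The relations on monomials reduce to recursions for the coefficients `p`, `q`. -/
lemma lorentzRelations_mono {p q : ℤ → ℂ} {c₁ c₂ : ℂ} {n a : ℤ}
    (hup : q n * n = q (n + 2) * (n + 4))
    (hdown_left : a * (p n * (q (n - 2) * (n - 2) - q n * (n + 2))) = 0)
    (hdown_right : (n - a) * (p n * (q (n - 2) * (n - 2) - q n * (n + 2))) = 0)
    (hdiag_left : a * ((n + 3) * p (n + 2) ^ 2 - (n - 1) * p n ^ 2 - q n ^ 2 - 1) = 0)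
    (hdiag_right : (n - a) * ((n + 3) * p (n + 2) ^ 2 - (n - 1) * p n ^ 2 - q n ^ 2 - 1) = 0)
    (hc₁ : q n * (n * (n + 2)) = 4 * c₁)
    (hc₂ : (n + 3) * p (n + 2) ^ 2 + n * (n - 1) * p n ^ 2 + q n ^ 2 * (n ^ 2 / 4 + n) =
      n ^ 2 / 4 - c₂) :
    LorentzRelations monoJ0 monoJp monoJm (monoK0 p q) (monoKp p q) (monoKm p q) c₁ c₂
      (mono n a) := by
  constructor
  case k0_kp =>
    rw [← sub_eq_zero]
    -- The difference of the two sides, sorted by degree: each coefficient is a multiple of one of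
    -- the assumed recursions. The other cases with a `trans` follow the same pattern.
    trans (p (n + 2) / 2 * (q n * n - q (n + 2) * (n + 4))) • mono (n + 2) (a + 2)
      + (-(((n : ℂ) - a) * ((n + 3) * p (n + 2) ^ 2 - (n - 1) * p n ^ 2 - q n ^ 2 - 1))) •
        mono n (a + 1)
      + ((1 - (n - a : ℂ)) / 2 * ((n - a) * (p n * (q (n - 2) * (n - 2) - q n * (n + 2))))) •
        mono (n - 2) a
    · simp only [monoJ0, monoJp, monoJm, monoK0, monoKp, monoKm, monoOp_mono, map_add, map_smul,
        add_assoc, sub_eq_add_neg, Int.reduceAdd, Int.reduceNeg, add_zero]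
      push_cast
      module
    · rw [hup, hdown_right, hdiag_right]; simp
  case k0_km =>
    rw [← sub_eq_zero]
    trans (p (n + 2) / 2 * (q n * n - q (n + 2) * (n + 4))) • mono (n + 2) a
      + ((a * ((n + 3) * p (n + 2) ^ 2 - (n - 1) * p n ^ 2 - q n ^ 2 - 1))) •
        mono n (a - 1)
      + ((1 - a) / 2 * (a * (p n * (q (n - 2) * (n - 2) - q n * (n + 2))))) •
        mono (n - 2) (a - 2)
    · simp only [monoJ0, monoJp, monoJm, monoK0, monoKp, monoKm, monoOp_mono, map_add, map_smul,
        add_assoc, sub_eq_add_neg, Int.reduceAdd, Int.reduceNeg, add_zero]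
      push_cast
      module
    · rw [hup, hdown_left, hdiag_left]; simp
  case kp_km =>
    rw [← sub_eq_zero]
    trans (p (n + 2) * (q (n + 2) * (n + 4) - q n * n)) • mono (n + 2) (a + 1)
      + (((n : ℂ) - a) * ((n + 3) * p (n + 2) ^ 2 - (n - 1) * p n ^ 2 - q n ^ 2 - 1)
        - a * ((n + 3) * p (n + 2) ^ 2 - (n - 1) * p n ^ 2 - q n ^ 2 - 1)) • mono n a
      + ((a - n : ℂ) * (a * (p n * (q (n - 2) * (n - 2) - q n * (n + 2))))) •
        mono (n - 2) (a - 1)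
    · simp only [monoJ0, monoJp, monoJm, monoK0, monoKp, monoKm, monoOp_mono, map_add, map_smul,
        add_assoc, sub_eq_add_neg, Int.reduceAdd, Int.reduceNeg, add_zero]
      push_cast
      module
    · rw [hup, hdown_left, hdiag_left, hdiag_right]; simp
  case casimir₁ =>
    rw [show c₁ = q n * (n * (n + 2)) / 4 by rw [hc₁]; ring]
    simp only [monoJ0, monoJp, monoJm, monoK0, monoKp, monoKm, monoOp_mono, map_add, map_smul,
      add_assoc, sub_eq_add_neg, Int.reduceAdd, Int.reduceNeg, add_zero]
    push_cast
    module
  case casimir₂ =>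
    rw [← sub_eq_zero]
    trans (p (n + 2) / 2 * (q (n + 2) * (n + 4) - q n * n)) •
        mono (n + 2) (a + 1)
      + (-(a * ((n + 3) * p (n + 2) ^ 2 - (n - 1) * p n ^ 2 - q n ^ 2 - 1))
        - ((n + 3) * p (n + 2) ^ 2 + n * (n - 1) * p n ^ 2 + q n ^ 2 * (n ^ 2 / 4 + n)
          - (n ^ 2 / 4 - c₂))) • mono n a
      + ((a - n : ℂ) / 2 * (a * (p n * (q (n - 2) * (n - 2) - q n * (n + 2))))) •
        mono (n - 2) (a - 1)
    · simp only [monoJ0, monoJp, monoJm, monoK0, monoKp, monoKm, monoOp_mono, map_add, map_smul,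
        add_assoc, sub_eq_add_neg, Int.reduceAdd, Int.reduceNeg, add_zero]
      push_cast
      module
    · rw [hup, hdown_left, hdiag_left, hc₂]; simp
  all_goals
    simp only [monoJ0, monoJp, monoJm, monoK0, monoKp, monoKm, monoOp_mono, map_add, map_smul,
      add_assoc, sub_eq_add_neg, Int.reduceAdd, Int.reduceNeg, add_zero]
    push_cast
    module

end MonomialModel


/-! ### Chiral halves -/

section Chiral

variable {W : Type*} [AddCommGroup W] [Module ℂ W] {J0 Jp Jm K0 Kp Km : Module.End ℂ W}

/-- A chiral half of the Lorentz algebra. -/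
lemma isSl2Rep_of_lorentzRelations {c₁ c₂ ε ν : ℂ} (hε : ε ^ 2 = -1)
    (hν : ν ^ 2 = c₂ + 2 * ε * c₁ + 1)
    (h : ∀ v, LorentzRelations J0 Jp Jm K0 Kp Km c₁ c₂ v) :
    IsSl2Rep ((1 / 2 : ℂ) • (J0 + ε • K0)) ((1 / 2 : ℂ) • (Jp + ε • Kp))
      ((1 / 2 : ℂ) • (Jm + ε • Km)) ν := by
  have hε' : ∀ v : W, (1 / 4 : ℂ) • ε • ε • v = -((1 / 4 : ℂ) • v) := by
    intro v; rw [smul_smul ε, ← sq, hε]; module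
  constructor <;> intro v <;>
    simp only [LinearMap.smul_apply, LinearMap.add_apply, map_add, map_smul]
  · rw [(h v).j0_jp, (h v).j0_kp, (h v).k0_jp, (h v).k0_kp]
    have := hε' (Jp v)
    linear_combination (norm := module) -this
  · rw [(h v).j0_jm, (h v).j0_km, (h v).k0_jm, (h v).k0_km]
    have := hε' (Jm v)
    linear_combination (norm := module) this
  · rw [(h v).jp_jm, (h v).jp_km, (h v).kp_jm, (h v).kp_km]
    have := hε' (J0 v)
    linear_combination (norm := module) (-2 : ℂ) • this
  · rw [hν, ← (h v).j0_k0]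
    have e1 := (h v).casimir₁
    -- Because `ε² = -1`, the quadratic Casimir of `(J + εK) / 2` is `(C₂ + 2ε C₁) / 4`.
    have e2 := (h v).casimir₂
    have e3 := hε' (K0 (K0 v) + Km (Kp v))
    linear_combination (norm := module) (1 / 4 : ℂ) • e2 + (ε / 2) • e1 + e3

end Chiral

/-! ### Recursions for the coefficients `P⁻` and `P` -/

section Coefficients

lemma csqrt_mul_self (z : ℂ) : Complex.sqrt z * Complex.sqrt z = z := by
  rw [← sq]
  exact Complex.cpow_nat_inv_pow z two_ne_zero

lemma csqrt_ne_zero {z : ℂ} (hz : z ≠ 0) : Complex.sqrt z ≠ 0 := fun h =>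
  hz (by rw [← csqrt_mul_self z, h, mul_zero])

/-- The coefficient `P⁻` at `n / 2`. -/
def monoP (l : ℚ) (r : ℂ) (n : ℤ) : ℂ := Pminus l r ((n : ℚ) / 2)

/-- The coefficient `P` at `n / 2`. -/
def monoQ (l : ℚ) (r : ℂ) (n : ℤ) : ℂ := Pzero l r ((n : ℚ) / 2)

lemma monoP_sq (l : ℚ) (r : ℂ) {n : ℤ} (hn : 2 ≤ n) :
    monoP l r n ^ 2 =
      ((n : ℂ) ^ 2 - 4 * l ^ 2) * ((n : ℂ) ^ 2 - 4 * r ^ 2) / (4 * n ^ 2 * ((n + 1) * (n - 1))) := by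
  have e : ∀ x y z w : ℂ, (Complex.sqrt x * Complex.sqrt y * Complex.sqrt z * Complex.sqrt w) ^ 2 =
      x * y * z * w := by
    intro x y z w
    linear_combination
      (Complex.sqrt y * Complex.sqrt z * Complex.sqrt w) ^ 2 * csqrt_mul_self x
        + x * (Complex.sqrt z * Complex.sqrt w) ^ 2 * csqrt_mul_self y
        + x * y * (Complex.sqrt w) ^ 2 * csqrt_mul_self z + x * y * z * csqrt_mul_self w
  have e' : ∀ j x y : ℂ, (j * Complex.sqrt x * Complex.sqrt y) ^ 2 = j ^ 2 * x * y := by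
    intro j x y
    linear_combination (j * Complex.sqrt y) ^ 2 * csqrt_mul_self x
        + j ^ 2 * x * csqrt_mul_self y
  rw [monoP, Pminus, div_pow, e, e']
  push_cast
  have h0 : (n : ℂ) ≠ 0 := by exact_mod_cast (show n ≠ 0 by omega)
  have h1 : (n : ℂ) + 1 ≠ 0 := by exact_mod_cast (show n + 1 ≠ 0 by omega)
  have h2 : (n : ℂ) - 1 ≠ 0 := by exact_mod_cast (show n - 1 ≠ 0 by omega)
  have h3 : 2 * ((n : ℂ) / 2) + 1 ≠ 0 := by ring_nf; rwa [add_comm]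
  have h4 : 2 * ((n : ℂ) / 2) - 1 ≠ 0 := by ring_nf; rwa [add_comm, ← sub_eq_add_neg]
  rw [show 2 * ((n : ℂ) / 2) + 1 = n + 1 by ring, show 2 * ((n : ℂ) / 2) - 1 = n - 1 by ring]
  field_simp
  ring

lemma Pminus_abs (l : ℚ) (r : ℂ) : Pminus l r |l| = 0 := by
  rcases abs_cases l with ⟨h, _⟩ | ⟨h, _⟩ <;> simp [Pminus, h]

variable {l : ℚ} {r : ℂ} {L : ℕ}

lemma monoP_bottom (hL : |l| = (L : ℚ) / 2) : monoP l r L = 0 := by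
  rw [monoP, Int.cast_natCast, ← hL, Pminus_abs]

lemma eq_zero_of_bottom (hL : |l| = (L : ℚ) / 2) (h : L = 0) : l = 0 := by
  rw [h] at hL; simpa using hL

lemma monoQ_mul (hL : |l| = (L : ℚ) / 2) (k : ℕ) {n : ℤ} (hn : n = L + 2 * k) :
    monoQ l r n * (n * (n + 2)) = 4 * (Complex.I * l * r) := by
  rcases eq_or_ne n 0 with h | h
  · rw [eq_zero_of_bottom hL (by omega), h]; simp
  · have h0 : (n : ℂ) ≠ 0 := by exact_mod_cast h
    have h2 : (n : ℂ) + 2 ≠ 0 := by exact_mod_cast (show n + 2 ≠ 0 by omega)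
    have h0' : (n : ℚ) / 2 ≠ 0 := div_ne_zero (by exact_mod_cast h) two_ne_zero
    have h3 : (n : ℂ) / 2 + 1 ≠ 0 := by
      intro h; apply h2; linear_combination 2 * h
    rw [monoQ, Pzero, if_neg h0']
    push_cast
    field_simp
    ring

lemma monoQ_up (hL : |l| = (L : ℚ) / 2) (k : ℕ) {n : ℤ} (hn : n = L + 2 * k) :
    monoQ l r n * n = monoQ l r (n + 2) * (n + 4) := by
  have h2 : (n : ℂ) + 2 ≠ 0 := by exact_mod_cast (show n + 2 ≠ 0 by omega)
  have e1 := monoQ_mul (r := r) hL k hn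
  have e2 := monoQ_mul (r := r) hL (k + 1) (n := n + 2) (by push_cast; omega)
  push_cast at e2
  apply mul_right_cancel₀ h2
  linear_combination e1 - e2

/-- At the bottom of the tower the recursion for `P` is not available, but there `P⁻` vanishes. -/
lemma monoQ_down (hL : |l| = (L : ℚ) / 2) (k : ℕ) {n : ℤ} (hn : n = L + 2 * k) :
    monoP l r n * (monoQ l r (n - 2) * (n - 2) - monoQ l r n * (n + 2)) = 0 := by
  rcases k with _ | k
  · rw [hn]
    simp [monoP_bottom hL]
  · have e := monoQ_up (r := r) hL k (n := n - 2) (by push_cast at hn; omega)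
    rw [sub_add_cancel] at e
    push_cast at e
    linear_combination (monoP l r n) * e

lemma sq_eq_of_abs (hL : |l| = (L : ℚ) / 2) : (l : ℂ) ^ 2 = (L : ℂ) ^ 2 / 4 := by
  have : l ^ 2 = (L : ℚ) ^ 2 / 4 := by rw [← sq_abs, hL]; ring
  have e := congrArg (fun x : ℚ => (x : ℂ)) this
  push_cast at e
  exact e

lemma monoQ_sq (hL : |l| = (L : ℚ) / 2) (k : ℕ) {n : ℤ} (hn : n = L + 2 * k) (h : n ≠ 0) :
    monoQ l r n ^ 2 = -16 * l ^ 2 * r ^ 2 / (n ^ 2 * (n + 2) ^ 2) := by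
  have h0 : (n : ℂ) ≠ 0 := by exact_mod_cast h
  have h2 : (n : ℂ) + 2 ≠ 0 := by exact_mod_cast (show n + 2 ≠ 0 by omega)
  rw [eq_div_iff (by positivity)]
  have e := monoQ_mul (r := r) hL k hn
  linear_combination (monoQ l r n * (n * (n + 2)) + 4 * (Complex.I * l * r)) * e
    + 16 * l ^ 2 * r ^ 2 * Complex.I_sq

lemma monoP_diag (hL : |l| = (L : ℚ) / 2) (k : ℕ) {n : ℤ} (hn : n = L + 2 * k) (h : n ≠ 0) :
    (n + 3) * monoP l r (n + 2) ^ 2 - (n - 1) * monoP l r n ^ 2 - monoQ l r n ^ 2 - 1 = 0 := by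
  have h0 : (n : ℂ) ≠ 0 := by exact_mod_cast h
  have h1 : (n : ℂ) + 1 ≠ 0 := by exact_mod_cast (show n + 1 ≠ 0 by omega)
  have h2 : (n : ℂ) + 2 ≠ 0 := by exact_mod_cast (show n + 2 ≠ 0 by omega)
  have h3 : (n : ℂ) + 3 ≠ 0 := by exact_mod_cast (show n + 3 ≠ 0 by omega)
  rw [monoQ_sq hL k hn h, monoP_sq l r (n := n + 2) (by omega)]
  push_cast
  rw [show ((n : ℂ) + 2 + 1) = n + 3 by ring, show ((n : ℂ) + 2 - 1) = n + 1 by ring]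
  -- The closed formula for the square of `P⁻` has a zero denominator at `n = 1`. That term carries
  -- the factor `n - 1`, and the identity then rests on `l² = 1 / 4`.
  by_cases hn1 : n = 1
  · have e := sq_eq_of_abs hL
    rw [show L = 1 by omega] at e
    rw [hn1, e]
    norm_num
    ring
  · have h4 : (n : ℂ) - 1 ≠ 0 := by exact_mod_cast (show n - 1 ≠ 0 by omega)
    rw [monoP_sq l r (n := n) (by omega)]
    field_simp
    ring

lemma monoP_casimir (hL : |l| = (L : ℚ) / 2) (k : ℕ) {n : ℤ} (hn : n = L + 2 * k) :
    (n + 3) * monoP l r (n + 2) ^ 2 + n * (n - 1) * monoP l r n ^ 2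
      + monoQ l r n ^ 2 * (n ^ 2 / 4 + n) = n ^ 2 / 4 - (l ^ 2 + r ^ 2 - 1) := by
  have h1 : (n : ℂ) + 1 ≠ 0 := by exact_mod_cast (show n + 1 ≠ 0 by omega)
  have h2 : (n : ℂ) + 2 ≠ 0 := by exact_mod_cast (show n + 2 ≠ 0 by omega)
  have h3 : (n : ℂ) + 3 ≠ 0 := by exact_mod_cast (show n + 3 ≠ 0 by omega)
  rw [monoP_sq l r (n := n + 2) (by omega)]
  push_cast
  rw [show ((n : ℂ) + 2 + 1) = n + 3 by ring, show ((n : ℂ) + 2 - 1) = n + 1 by ring]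
  by_cases h : n = 0
  · rw [eq_zero_of_bottom hL (by omega), h]
    norm_num
    ring
  have h0 : (n : ℂ) ≠ 0 := by exact_mod_cast h
  rw [monoQ_sq hL k hn h]
  by_cases hn1 : n = 1
  · have e := sq_eq_of_abs hL
    rw [show L = 1 by omega] at e
    rw [hn1, e]
    norm_num
    ring
  · have h4 : (n : ℂ) - 1 ≠ 0 := by exact_mod_cast (show n - 1 ≠ 0 by omega)
    rw [monoP_sq l r (n := n) (by omega)]
    field_simp
    ring

/-- The diagonal recursion may fail at `n = 0`; the bounds on `a` then force `a = 0`, so its factors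
`a` and `n - a` vanish. -/
lemma lorentzRelations_mono_of_tower (hL : |l| = (L : ℚ) / 2) (k : ℕ) {n : ℤ}
    (hn : n = L + 2 * k) {a : ℤ} (ha : 0 ≤ a) (ha' : a ≤ n) :
    LorentzRelations monoJ0 monoJp monoJm (monoK0 (monoP l r) (monoQ l r))
      (monoKp (monoP l r) (monoQ l r)) (monoKm (monoP l r) (monoQ l r))
      (Complex.I * l * r) (l ^ 2 + r ^ 2 - 1) (mono n a) := by
  have hd := monoQ_down (r := r) hL k hn
  refine lorentzRelations_mono (monoQ_up hL k hn) (by rw [hd, mul_zero]) (by rw [hd, mul_zero])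
    ?_ ?_ (monoQ_mul hL k hn) (monoP_casimir hL k hn)
  all_goals
    by_cases h : n = 0
    · rw [show a = 0 by omega, h]; simp
    · rw [monoP_diag hL k hn h, mul_zero]

end Coefficients


/-! ### Embedding `V` into the monomials -/

section MonomialEmbedding

/-- The product of the square roots of `1, …, n`. -/
def sqrtFactorial (n : ℕ) : ℂ := ∏ i ∈ Finset.range n, Complex.sqrt ((i : ℂ) + 1)

lemma sqrtFactorial_succ (n : ℕ) :
    sqrtFactorial (n + 1) = sqrtFactorial n * Complex.sqrt ((n : ℂ) + 1) :=
  Finset.prod_range_succ _ _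

lemma csqrt_succ_ne_zero (n : ℕ) : Complex.sqrt ((n : ℂ) + 1) ≠ 0 :=
  csqrt_ne_zero (by exact_mod_cast Nat.succ_ne_zero n)

lemma sqrtFactorial_ne_zero (n : ℕ) : sqrtFactorial n ≠ 0 :=
  Finset.prod_ne_zero_iff.2 fun i _ => csqrt_succ_ne_zero i

lemma sqrt_mul_inv_sqrtFactorial_succ (n : ℕ) :
    Complex.sqrt ((n : ℂ) + 1) * (sqrtFactorial (n + 1))⁻¹ = (sqrtFactorial n)⁻¹ := by
  rw [sqrtFactorial_succ, mul_inv]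
  field_simp [csqrt_succ_ne_zero n]

lemma sqrt_mul_inv_sqrtFactorial (n : ℕ) :
    Complex.sqrt ((n : ℂ) + 1) * (sqrtFactorial n)⁻¹ = (n + 1) * (sqrtFactorial (n + 1))⁻¹ := by
  rw [← sqrt_mul_inv_sqrtFactorial_succ]
  linear_combination (sqrtFactorial (n + 1))⁻¹ * csqrt_mul_self ((n : ℂ) + 1)

/-- The image of `|j, m⟩` in the space of monomials. -/
def modelKet (j m : ℚ) : MonomialSpace :=
  ((sqrtFactorial ⌊j + m⌋.toNat)⁻¹ * (sqrtFactorial ⌊j - m⌋.toNat)⁻¹) • mono ⌊2 * j⌋ ⌊j + m⌋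

/-- The embedding of `V_{l,r}` into the space of monomials. -/
def monoEmb (l : ℚ) (r : ℂ) : V l r →ₗ[ℂ] MonomialSpace :=
  Finsupp.linearCombination ℂ fun p : labels l r => modelKet p.1.1 p.1.2

variable {l : ℚ} {r : ℂ} {L : ℕ}

lemma exists_of_mem_labels (hL : |l| = (L : ℚ) / 2) {p : ℚ × ℚ} (hp : p ∈ labels l r) :
    ∃ k a b : ℕ, (a : ℤ) + b = L + 2 * k ∧ p.1 = ((a : ℚ) + b) / 2 ∧ p.2 = ((a : ℚ) - b) / 2 := by
  obtain ⟨⟨k, hk⟩, -, ⟨a, ha, hm⟩⟩ := hp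
  rw [hL] at hk
  have hle : a ≤ L + 2 * k := by
    have : (a : ℚ) ≤ L + 2 * k := by linarith
    exact_mod_cast this
  obtain ⟨b, hb⟩ := Nat.exists_eq_add_of_le hle
  have hb' : (L : ℚ) + 2 * k = a + b := by exact_mod_cast hb
  exact ⟨k, a, b, by omega, by rw [hk]; linarith, by rw [ha, hk]; linarith⟩

lemma mem_labels (hL : |l| = (L : ℚ) / 2) (hP : ∀ i, InTower l i → Pplus l r i ≠ 0) {k a b : ℕ}
    (h : (a : ℤ) + b = L + 2 * k) {j m : ℚ} (hj : j = ((a : ℚ) + b) / 2)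
    (hm : m = ((a : ℚ) - b) / 2) : (j, m) ∈ labels l r := by
  have h' : (a : ℚ) + b = L + 2 * k := by exact_mod_cast h
  refine ⟨⟨k, ?_⟩, fun i hi _ => hP i hi, ⟨a, ?_, ?_⟩⟩
  · rw [hL]; simp only [hj]; linarith
  · simp only [hj, hm]; ring
  · have : (0 : ℚ) ≤ b := Nat.cast_nonneg b
    simp only [hj, hm]; linarith

lemma modelKet_eq {a b : ℕ} {j m : ℚ} (hj : j = ((a : ℚ) + b) / 2) (hm : m = ((a : ℚ) - b) / 2) :
    modelKet j m = ((sqrtFactorial a)⁻¹ * (sqrtFactorial b)⁻¹) • mono (a + b) a := by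
  have e1 : j + m = ((a : ℤ) : ℚ) := by rw [hj, hm]; push_cast; ring
  have e2 : j - m = ((b : ℤ) : ℚ) := by rw [hj, hm]; push_cast; ring
  have e3 : 2 * j = ((a + b : ℤ) : ℚ) := by rw [hj]; push_cast; ring
  rw [modelKet, e1, e2, e3, Int.floor_intCast, Int.floor_intCast, Int.floor_intCast,
    Int.toNat_natCast, Int.toNat_natCast]

lemma monoEmb_ket (hL : |l| = (L : ℚ) / 2) (hP : ∀ i, InTower l i → Pplus l r i ≠ 0) {k a b : ℕ}
    (h : (a : ℤ) + b = L + 2 * k) {j m : ℚ} (hj : j = ((a : ℚ) + b) / 2)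
    (hm : m = ((a : ℚ) - b) / 2) :
    monoEmb l r (ket l r j m) =
      ((sqrtFactorial a)⁻¹ * (sqrtFactorial b)⁻¹) • mono (a + b) a := by
  rw [ket, dif_pos (mem_labels hL hP h hj hm), monoEmb, Finsupp.linearCombination_single, one_smul,
    modelKet_eq hj hm]

lemma monoEmb_injective (hL : |l| = (L : ℚ) / 2) : Function.Injective (monoEmb l r) := by
  have hli : LinearIndependent ℂ fun p : labels l r => mono ⌊2 * p.1.1⌋ ⌊p.1.1 + p.1.2⌋ := by
    have := (Finsupp.basisSingleOne (R := ℂ) (ι := ℤ × ℤ)).linearIndependent.comp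
      (fun p : labels l r => (⌊2 * p.1.1⌋, ⌊p.1.1 + p.1.2⌋)) ?_
    · convert this using 2
      simp [mono]
    · rintro ⟨p, hp⟩ ⟨p', hp'⟩ e
      obtain ⟨k, a, b, -, hj, hm⟩ := exists_of_mem_labels hL hp
      obtain ⟨k', a', b', -, hj', hm'⟩ := exists_of_mem_labels hL hp'
      simp only [Prod.mk.injEq] at e
      rw [show 2 * p.1 = ((a + b : ℤ) : ℚ) by rw [hj]; push_cast; ring,
        show 2 * p'.1 = ((a' + b' : ℤ) : ℚ) by rw [hj']; push_cast; ring,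
        show p.1 + p.2 = ((a : ℤ) : ℚ) by rw [hj, hm]; push_cast; ring,
        show p'.1 + p'.2 = ((a' : ℤ) : ℚ) by rw [hj', hm']; push_cast; ring] at e
      simp only [Int.floor_intCast] at e
      have ha : a = a' := by omega
      have hb : b = b' := by omega
      exact Subtype.ext (Prod.ext (by rw [hj, hj', ha, hb]) (by rw [hm, hm', ha, hb]))
  exact hli.units_smul fun p => Units.mk0
    ((sqrtFactorial ⌊p.1.1 + p.1.2⌋.toNat)⁻¹ * (sqrtFactorial ⌊p.1.1 - p.1.2⌋.toNat)⁻¹)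
    (mul_ne_zero (inv_ne_zero (sqrtFactorial_ne_zero _)) (inv_ne_zero (sqrtFactorial_ne_zero _)))

lemma opV_ket (f : ℚ → ℚ → V l r) (p : labels l r) :
    opV l r f (Finsupp.single p 1) = f p.1.1 p.1.2 := by
  rw [opV, Finsupp.linearCombination_single, one_smul]

lemma monoEmb_opV (hL : |l| = (L : ℚ) / 2) (f : ℚ → ℚ → V l r) (T : Module.End ℂ MonomialSpace)
    (h : ∀ k a b : ℕ, (a : ℤ) + b = L + 2 * k →
      monoEmb l r (f (((a : ℚ) + b) / 2) (((a : ℚ) - b) / 2)) =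
        ((sqrtFactorial a)⁻¹ * (sqrtFactorial b)⁻¹) • T (mono (a + b) a)) (v : V l r) :
    monoEmb l r (opV l r f v) = T (monoEmb l r v) := by
  suffices monoEmb l r ∘ₗ opV l r f = T ∘ₗ monoEmb l r from LinearMap.congr_fun this v
  refine Finsupp.lhom_ext' fun p => LinearMap.ext_ring ?_
  obtain ⟨k, a, b, hab, hj, hm⟩ := exists_of_mem_labels hL p.2
  simp only [LinearMap.comp_apply, Finsupp.lsingle_apply]
  rw [opV_ket, monoEmb, Finsupp.linearCombination_single, one_smul, modelKet_eq hj hm, map_smul,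
    ← h k a b hab, hj, hm, monoEmb]

section Shifts

variable (hL : |l| = (L : ℚ) / 2) (hP : ∀ i, InTower l i → Pplus l r i ≠ 0) {k a b : ℕ}
  (h : (a : ℤ) + b = L + 2 * k) {j m : ℚ}

include hL hP h

/-- The square roots from the action stay on the left because they vanish exactly when the shifted
vector leaves the range of `m`; otherwise they turn the normalisation of the new vector into that of
the old one. The remaining shift lemmas work in the same way. -/
lemma monoEmb_ket_raise (hj : j = ((a : ℚ) + b) / 2) (hm : m = ((a : ℚ) - b) / 2 + 1) :
    (Complex.sqrt b * Complex.sqrt (a + 1)) • monoEmb l r (ket l r j m) =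
      ((sqrtFactorial a)⁻¹ * (sqrtFactorial b)⁻¹ * b) • mono (a + b) (a + 1) := by
  rcases b with _ | b
  · simp
  · rw [monoEmb_ket hL hP (k := k) (a := a + 1) (b := b) (by push_cast at *; omega)
      (by rw [hj]; push_cast; ring) (by rw [hm]; push_cast; ring), smul_smul]
    push_cast
    rw [show (a : ℤ) + 1 + b = a + (b + 1) by ring]
    congr 1
    rw [← sqrt_mul_inv_sqrtFactorial_succ a]
    linear_combination (Complex.sqrt (a + 1) * (sqrtFactorial (a + 1))⁻¹) *
      sqrt_mul_inv_sqrtFactorial b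

lemma monoEmb_ket_lower (hj : j = ((a : ℚ) + b) / 2) (hm : m = ((a : ℚ) - b) / 2 - 1) :
    (Complex.sqrt a * Complex.sqrt (b + 1)) • monoEmb l r (ket l r j m) =
      ((sqrtFactorial a)⁻¹ * (sqrtFactorial b)⁻¹ * a) • mono (a + b) (a - 1) := by
  rcases a with _ | a
  · simp
  · rw [monoEmb_ket hL hP (k := k) (a := a) (b := b + 1) (by push_cast at *; omega)
      (by rw [hj]; push_cast; ring) (by rw [hm]; push_cast; ring), smul_smul]
    push_cast
    rw [show (a : ℤ) + 1 + b = a + (b + 1) by ring, add_sub_cancel_right]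
    congr 1
    rw [← sqrt_mul_inv_sqrtFactorial_succ b]
    linear_combination (Complex.sqrt (b + 1) * (sqrtFactorial (b + 1))⁻¹) *
      sqrt_mul_inv_sqrtFactorial a

lemma monoEmb_ket_up (hj : j = ((a : ℚ) + b) / 2 + 1) (hm : m = ((a : ℚ) - b) / 2) :
    (Complex.sqrt (a + 1) * Complex.sqrt (b + 1)) • monoEmb l r (ket l r j m) =
      ((sqrtFactorial a)⁻¹ * (sqrtFactorial b)⁻¹) • mono (a + b + 2) (a + 1) := by
  rw [monoEmb_ket hL hP (k := k + 1) (a := a + 1) (b := b + 1) (by push_cast at *; omega)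
      (by rw [hj]; push_cast; ring) (by rw [hm]; push_cast; ring), smul_smul]
  push_cast
  rw [show (a : ℤ) + 1 + (b + 1) = a + b + 2 by ring, ← sqrt_mul_inv_sqrtFactorial_succ a,
    ← sqrt_mul_inv_sqrtFactorial_succ b]
  congr 1
  ring

lemma monoEmb_ket_up_raise (hj : j = ((a : ℚ) + b) / 2 + 1) (hm : m = ((a : ℚ) - b) / 2 + 1) :
    (Complex.sqrt (a + 1) * Complex.sqrt (a + 2)) • monoEmb l r (ket l r j m) =
      ((sqrtFactorial a)⁻¹ * (sqrtFactorial b)⁻¹) • mono (a + b + 2) (a + 2) := by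
  rw [monoEmb_ket hL hP (k := k + 1) (a := a + 2) (b := b) (by push_cast at *; omega)
      (by rw [hj]; push_cast; ring) (by rw [hm]; push_cast; ring), smul_smul]
  push_cast
  have e := sqrt_mul_inv_sqrtFactorial_succ (a + 1)
  push_cast at e
  rw [show (a : ℂ) + 1 + 1 = a + 2 by ring] at e
  rw [show (a : ℤ) + 2 + b = a + b + 2 by ring, ← sqrt_mul_inv_sqrtFactorial_succ a, ← e]
  congr 1
  ring

lemma monoEmb_ket_up_lower (hj : j = ((a : ℚ) + b) / 2 + 1) (hm : m = ((a : ℚ) - b) / 2 - 1) :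
    (Complex.sqrt (b + 1) * Complex.sqrt (b + 2)) • monoEmb l r (ket l r j m) =
      ((sqrtFactorial a)⁻¹ * (sqrtFactorial b)⁻¹) • mono (a + b + 2) a := by
  rw [monoEmb_ket hL hP (k := k + 1) (a := a) (b := b + 2) (by push_cast at *; omega)
      (by rw [hj]; push_cast; ring) (by rw [hm]; push_cast; ring), smul_smul]
  push_cast
  have e := sqrt_mul_inv_sqrtFactorial_succ (b + 1)
  push_cast at e
  rw [show (b : ℂ) + 1 + 1 = b + 2 by ring] at e
  rw [show (a : ℤ) + (b + 2) = a + b + 2 by ring, ← sqrt_mul_inv_sqrtFactorial_succ b, ← e]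
  congr 1
  ring

/-- The factor `monoP` is kept since it settles the bottom of the tower, where there is no vector
with smaller `j`. -/
lemma monoEmb_ket_down (hj : j = ((a : ℚ) + b) / 2 - 1) (hm : m = ((a : ℚ) - b) / 2) :
    (monoP l r (a + b) * Complex.sqrt a * Complex.sqrt b) • monoEmb l r (ket l r j m) =
      ((sqrtFactorial a)⁻¹ * (sqrtFactorial b)⁻¹ * (monoP l r (a + b) * (a * b))) •
        mono (a + b - 2) (a - 1) := by
  rcases k with _ | k
  · rw [show (a : ℤ) + b = L by omega, monoP_bottom hL]; simp
  rcases a with _ | a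
  · simp
  rcases b with _ | b
  · simp
  rw [monoEmb_ket hL hP (k := k) (a := a) (b := b) (by push_cast at *; omega)
      (by rw [hj]; push_cast; ring) (by rw [hm]; push_cast; ring), smul_smul]
  push_cast
  rw [show (a : ℤ) + 1 + (b + 1) - 2 = a + b by ring, add_sub_cancel_right]
  congr 1
  linear_combination (monoP l r (a + 1 + (b + 1))) *
    (Complex.sqrt (b + 1) * (sqrtFactorial b)⁻¹ * sqrt_mul_inv_sqrtFactorial a
      + (a + 1) * (sqrtFactorial (a + 1))⁻¹ * sqrt_mul_inv_sqrtFactorial b)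

lemma monoEmb_ket_down_raise (hj : j = ((a : ℚ) + b) / 2 - 1) (hm : m = ((a : ℚ) - b) / 2 + 1) :
    (monoP l r (a + b) * Complex.sqrt b * Complex.sqrt (b - 1)) • monoEmb l r (ket l r j m) =
      ((sqrtFactorial a)⁻¹ * (sqrtFactorial b)⁻¹ * (monoP l r (a + b) * (b * (b - 1)))) •
        mono (a + b - 2) a := by
  rcases k with _ | k
  · rw [show (a : ℤ) + b = L by omega, monoP_bottom hL]; simp
  rcases b with _ | _ | b
  · simp
  · simp
  rw [monoEmb_ket hL hP (k := k) (a := a) (b := b) (by push_cast at *; omega)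
      (by rw [hj]; push_cast; ring) (by rw [hm]; push_cast; ring), smul_smul]
  have e := sqrt_mul_inv_sqrtFactorial (b + 1)
  push_cast at e ⊢
  rw [show (a : ℤ) + (b + 1 + 1) - 2 = a + b by ring, add_sub_cancel_right]
  congr 1
  linear_combination (monoP l r (a + (b + 1 + 1))) * (sqrtFactorial a)⁻¹ *
    (Complex.sqrt (b + 1 + 1) * sqrt_mul_inv_sqrtFactorial b + (b + 1) * e)

lemma monoEmb_ket_down_lower (hj : j = ((a : ℚ) + b) / 2 - 1) (hm : m = ((a : ℚ) - b) / 2 - 1) :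
    (monoP l r (a + b) * Complex.sqrt a * Complex.sqrt (a - 1)) • monoEmb l r (ket l r j m) =
      ((sqrtFactorial a)⁻¹ * (sqrtFactorial b)⁻¹ * (monoP l r (a + b) * (a * (a - 1)))) •
        mono (a + b - 2) (a - 2) := by
  rcases k with _ | k
  · rw [show (a : ℤ) + b = L by omega, monoP_bottom hL]; simp
  rcases a with _ | _ | a
  · simp
  · simp
  rw [monoEmb_ket hL hP (k := k) (a := a) (b := b) (by push_cast at *; omega)
      (by rw [hj]; push_cast; ring) (by rw [hm]; push_cast; ring), smul_smul]
  have e := sqrt_mul_inv_sqrtFactorial (a + 1)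
  push_cast at e ⊢
  rw [show (a : ℤ) + 1 + 1 + b - 2 = a + b by ring, add_sub_cancel_right,
    show (a : ℤ) + 1 + 1 - 2 = a by ring]
  congr 1
  linear_combination (monoP l r (a + 1 + 1 + b)) * (sqrtFactorial b)⁻¹ *
    (Complex.sqrt (a + 1 + 1) * sqrt_mul_inv_sqrtFactorial a + (a + 1) * e)

end Shifts

end MonomialEmbedding


/-! ### Transfer of the relations to `V` -/

section Intertwining

variable {l : ℚ} {r : ℂ} {L : ℕ}

lemma ladder_one_eq (a b : ℂ) {j m : ℚ} (hj : (j : ℂ) = (a + b) / 2) (hm : (m : ℂ) = (a - b) / 2) :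
    ladder 1 j m = Complex.sqrt b * Complex.sqrt (a + 1) := by
  rw [ladder, hj, hm]
  push_cast
  congr 2 <;> ring

lemma ladder_neg_one_eq (a b : ℂ) {j m : ℚ} (hj : (j : ℂ) = (a + b) / 2)
    (hm : (m : ℂ) = (a - b) / 2) :
    ladder (-1) j m = Complex.sqrt a * Complex.sqrt (b + 1) := by
  rw [ladder, hj, hm]
  push_cast
  congr 2 <;> ring

lemma Pminus_eq_monoP (a b : ℕ) : Pminus l r (((a : ℚ) + b) / 2) = monoP l r (a + b) := by
  simp [monoP]

lemma Pplus_eq_monoP (a b : ℕ) : Pplus l r (((a : ℚ) + b) / 2) = monoP l r (a + b + 2) := by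
  rw [Pplus, monoP]
  congr 1
  push_cast
  ring

lemma Pzero_eq_monoQ (a b : ℕ) : Pzero l r (((a : ℚ) + b) / 2) = monoQ l r (a + b) := by
  simp [monoQ]

lemma monoEmb_J0V (hL : |l| = (L : ℚ) / 2) (hP : ∀ i, InTower l i → Pplus l r i ≠ 0)
    (v : V l r) : monoEmb l r (J0V l r v) = monoJ0 (monoEmb l r v) := by
  refine monoEmb_opV hL _ _ (fun k a b h => ?_) v
  rw [map_smul, monoEmb_ket hL hP h rfl rfl, monoJ0, monoOp_mono]
  push_cast
  module

lemma monoEmb_JpV (hL : |l| = (L : ℚ) / 2) (hP : ∀ i, InTower l i → Pplus l r i ≠ 0)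
    (v : V l r) : monoEmb l r (JpmV l r 1 v) = monoJp (monoEmb l r v) := by
  refine monoEmb_opV hL _ _ (fun k a b h => ?_) v
  rw [map_smul, ladder_one_eq a b (by push_cast; ring) (by push_cast; ring),
    monoEmb_ket_raise hL hP h rfl (by push_cast; ring), monoJp, monoOp_mono]
  push_cast
  module

lemma monoEmb_JmV (hL : |l| = (L : ℚ) / 2) (hP : ∀ i, InTower l i → Pplus l r i ≠ 0)
    (v : V l r) : monoEmb l r (JpmV l r (-1) v) = monoJm (monoEmb l r v) := by
  refine monoEmb_opV hL _ _ (fun k a b h => ?_) v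
  rw [map_smul, ladder_neg_one_eq a b (by push_cast; ring) (by push_cast; ring),
    monoEmb_ket_lower hL hP h rfl (by push_cast; ring), monoJm, monoOp_mono]
  push_cast
  module

lemma monoEmb_K0V (hL : |l| = (L : ℚ) / 2) (hP : ∀ i, InTower l i → Pplus l r i ≠ 0)
    (v : V l r) :
    monoEmb l r (K0V l r v) = monoK0 (monoP l r) (monoQ l r) (monoEmb l r v) := by
  refine monoEmb_opV hL _ _ (fun k a b h => ?_) v
  have e1 := monoEmb_ket_up hL hP h rfl rfl
  have e2 := monoEmb_ket_down hL hP h rfl rfl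
  rw [map_add, map_add, map_smul, map_smul, map_smul, monoEmb_ket hL hP h rfl rfl, Pminus_eq_monoP,
    Pplus_eq_monoP, Pzero_eq_monoQ, monoK0, monoOp_mono]
  push_cast
  rw [show ((a : ℂ) + b) / 2 + (a - b) / 2 = a by ring,
    show ((a : ℂ) + b) / 2 - (a - b) / 2 = b by ring, e2, mul_assoc (monoP l r (a + b + 2)),
    mul_smul (monoP l r (a + b + 2)), e1]
  module

lemma monoEmb_KpV (hL : |l| = (L : ℚ) / 2) (hP : ∀ i, InTower l i → Pplus l r i ≠ 0)
    (v : V l r) :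
    monoEmb l r (KpmV l r 1 v) = monoKp (monoP l r) (monoQ l r) (monoEmb l r v) := by
  refine monoEmb_opV hL _ _ (fun k a b h => ?_) v
  have e1 := monoEmb_ket_up_raise hL hP h rfl rfl
  have e2 := monoEmb_ket_down_raise hL hP h rfl rfl
  have e3 := monoEmb_ket_raise hL hP h rfl rfl
  rw [map_add, map_add, map_smul, map_smul, map_smul,
    ladder_one_eq a b (by push_cast; ring) (by push_cast; ring), Pminus_eq_monoP,
    Pplus_eq_monoP, Pzero_eq_monoQ, monoKp, monoOp_mono, Int.cast_one]
  push_cast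
  rw [show ((a : ℂ) + b) / 2 + 1 * ((a - b) / 2) = a by ring,
    show ((a : ℂ) + b) / 2 - 1 * ((a - b) / 2) = b by ring, mul_smul (monoQ l r (a + b)), e3,
    one_mul, e2, mul_assoc (-1 * monoP l r (a + b + 2)),
    mul_smul (-1 * monoP l r (a + b + 2)), e1]
  module

lemma monoEmb_KmV (hL : |l| = (L : ℚ) / 2) (hP : ∀ i, InTower l i → Pplus l r i ≠ 0)
    (v : V l r) :
    monoEmb l r (KpmV l r (-1) v) = monoKm (monoP l r) (monoQ l r) (monoEmb l r v) := by
  refine monoEmb_opV hL _ _ (fun k a b h => ?_) v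
  have e1 := monoEmb_ket_up_lower hL hP h rfl rfl
  have e2 := monoEmb_ket_down_lower hL hP h rfl rfl
  have e3 := monoEmb_ket_lower hL hP h rfl rfl
  rw [map_add, map_add, map_smul, map_smul, map_smul,
    ladder_neg_one_eq a b (by push_cast; ring) (by push_cast; ring), Pminus_eq_monoP,
    Pplus_eq_monoP, Pzero_eq_monoQ, monoKm, monoOp_mono, Int.cast_neg, Int.cast_one]
  push_cast
  rw [← sub_eq_add_neg (((a : ℚ) - b) / 2), show ((a : ℂ) + b) / 2 + -1 * ((a - b) / 2) = b by ring,
    show ((a : ℂ) + b) / 2 - -1 * ((a - b) / 2) = a by ring, mul_smul (monoQ l r (a + b)), e3,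
    mul_assoc (-1 : ℂ), mul_assoc (-1 : ℂ), mul_smul (-1 : ℂ), e2, neg_neg, one_mul,
    mul_assoc (monoP l r (a + b + 2)), mul_smul (monoP l r (a + b + 2)), e1]
  module

/-- The vectors satisfying the Lorentz relations contain the span of any set of such vectors. -/
lemma LorentzRelations.of_span {W : Type*} [AddCommGroup W] [Module ℂ W]
    {J0 Jp Jm K0 Kp Km : Module.End ℂ W} {c₁ c₂ : ℂ} {s : Set W}
    (hs : ∀ v ∈ s, LorentzRelations J0 Jp Jm K0 Kp Km c₁ c₂ v) {v : W}
    (hv : v ∈ Submodule.span ℂ s) : LorentzRelations J0 Jp Jm K0 Kp Km c₁ c₂ v := by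
  induction hv using Submodule.span_induction with
  | mem v h => exact hs v h
  | zero => constructor <;> simp
  | add v w _ _ h h' =>
    obtain ⟨a1, a2, a3, a4, a5, a6, a7, a8, a9, a10, a11, a12, a13, a14, a15⟩ := h
    obtain ⟨b1, b2, b3, b4, b5, b6, b7, b8, b9, b10, b11, b12, b13, b14, b15⟩ := h'
    constructor <;> simp only [map_add, smul_add]
    · rw [a1, b1]; abel
    · rw [a2, b2]; abel
    · rw [a3, b3]; abel
    · rw [a4, b4]
    · rw [a5, b5]; abel
    · rw [a6, b6]; abel
    · rw [a7, b7]; abel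
    · rw [a8, b8]; abel
    · rw [a9, b9]; abel
    · rw [a10, b10]; abel
    · rw [a11, b11]; abel
    · rw [a12, b12]; abel
    · rw [a13, b13]; abel
    · rw [← a14, ← b14]; module
    · rw [← a15, ← b15]; module
  | smul c v _ h =>
    obtain ⟨a1, a2, a3, a4, a5, a6, a7, a8, a9, a10, a11, a12, a13, a14, a15⟩ := h
    constructor <;> simp only [map_smul]
    · rw [a1]; module
    · rw [a2]; module
    · rw [a3]; module
    · rw [a4]
    · rw [a5]; module
    · rw [a6]; module
    · rw [a7]; module
    · rw [a8]; module
    · rw [a9]; module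
    · rw [a10]; module
    · rw [a11]; module
    · rw [a12]; module
    · rw [a13]; module
    · rw [smul_comm c₁, ← a14]; module
    · rw [smul_comm c₂, ← a15]; module

/-- The relations are required only at the image `f v`, since the model operators need not satisfy
them on all monomials. -/
lemma LorentzRelations.of_injective {W W' : Type*} [AddCommGroup W] [Module ℂ W] [AddCommGroup W']
    [Module ℂ W'] {J0 Jp Jm K0 Kp Km : Module.End ℂ W} {J0' Jp' Jm' K0' Kp' Km' : Module.End ℂ W'}
    {c₁ c₂ : ℂ} {f : W →ₗ[ℂ] W'} (hf : Function.Injective f)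
    (h1 : ∀ v, f (J0 v) = J0' (f v)) (h2 : ∀ v, f (Jp v) = Jp' (f v))
    (h3 : ∀ v, f (Jm v) = Jm' (f v)) (h4 : ∀ v, f (K0 v) = K0' (f v))
    (h5 : ∀ v, f (Kp v) = Kp' (f v)) (h6 : ∀ v, f (Km v) = Km' (f v)) {v : W}
    (h : LorentzRelations J0' Jp' Jm' K0' Kp' Km' c₁ c₂ (f v)) :
    LorentzRelations J0 Jp Jm K0 Kp Km c₁ c₂ v := by
  obtain ⟨a1, a2, a3, a4, a5, a6, a7, a8, a9, a10, a11, a12, a13, a14, a15⟩ := h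
  constructor <;> apply hf <;> simp only [map_add, map_sub, map_smul, h1, h2, h3, h4, h5, h6] <;>
    assumption

lemma lorentzRelations_V (hL : |l| = (L : ℚ) / 2) (hP : ∀ i, InTower l i → Pplus l r i ≠ 0)
    (v : V l r) :
    LorentzRelations (J0V l r) (JpmV l r 1) (JpmV l r (-1)) (K0V l r) (KpmV l r 1) (KpmV l r (-1))
      (Complex.I * l * r) (l ^ 2 + r ^ 2 - 1) v := by
  refine .of_injective (monoEmb_injective hL) (monoEmb_J0V hL hP) (monoEmb_JpV hL hP)
    (monoEmb_JmV hL hP) (monoEmb_K0V hL hP) (monoEmb_KpV hL hP) (monoEmb_KmV hL hP) ?_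
  refine .of_span (s := {w | ∃ k a b : ℕ, (a : ℤ) + b = L + 2 * k ∧ w = mono (a + b) a}) ?_ ?_
  · rintro _ ⟨k, a, b, h, rfl⟩
    exact lorentzRelations_mono_of_tower hL k h (by omega) (by omega)
  · rw [monoEmb, Finsupp.linearCombination_apply]
    refine Submodule.sum_mem _ fun p _ => Submodule.smul_mem _ _ ?_
    obtain ⟨k, a, b, hab, hj, hm⟩ := exists_of_mem_labels hL p.2
    rw [modelKet_eq hj hm]
    exact Submodule.smul_mem _ _ (Submodule.subset_span ⟨k, a, b, hab, rfl⟩)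

/-- No power of the raising operator of a chiral half annihilates the lowest highest-weight
vector. -/
lemma pow_chiral_raise_ne_zero (hL : |l| = (L : ℚ) / 2) (hP : ∀ i, InTower l i → Pplus l r i ≠ 0)
    {ε : ℂ} (hε : ε ≠ 0) (d : ℕ) :
    (((1 / 2 : ℂ) • (JpmV l r 1 + ε • KpmV l r 1)) ^ d) (ket l r |l| |l|) ≠ 0 := by
  have key : ∃ c : ℂ, c ≠ 0 ∧
      monoEmb l r ((((1 / 2 : ℂ) • (JpmV l r 1 + ε • KpmV l r 1)) ^ d) (ket l r |l| |l|)) =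
        c • mono (L + 2 * d) (L + 2 * d) := by
    induction d with
    | zero =>
      refine ⟨(sqrtFactorial L)⁻¹ * (sqrtFactorial 0)⁻¹,
        mul_ne_zero (inv_ne_zero (sqrtFactorial_ne_zero _)) (inv_ne_zero (sqrtFactorial_ne_zero _)),
        ?_⟩
      rw [pow_zero, Module.End.one_apply, monoEmb_ket hL hP (k := 0) (a := L) (b := 0) (by simp)
        (by rw [hL]; simp) (by rw [hL]; simp)]
      simp
    | succ d ih =>
      obtain ⟨c, hc, e⟩ := ih
      -- On the pure power `x^n` one has `n - a = 0`, which kills `J₊` and all of `K₊` except the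
      -- part raising `j`; that part contributes `-P⁺`.
      refine ⟨c * (1 / 2 * (ε * -monoP l r (L + 2 * d + 2))), ?_, ?_⟩
      · refine mul_ne_zero hc (mul_ne_zero (by norm_num) (mul_ne_zero hε (neg_ne_zero.2 ?_)))
        have := hP (((L + 2 * d : ℕ) + (0 : ℕ) : ℚ) / 2) ⟨d, by rw [hL]; push_cast; ring⟩
        rw [Pplus_eq_monoP] at this
        push_cast at this
        rwa [add_zero] at this
      · rw [pow_succ', Module.End.mul_apply]
        simp only [LinearMap.smul_apply, LinearMap.add_apply, map_add, map_smul,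
          monoEmb_JpV hL hP, monoEmb_KpV hL hP, e]
        rw [monoJp, monoKp, monoOp_mono, monoOp_mono]
        push_cast
        rw [sub_self, show (L : ℤ) + 2 * (d + 1) = L + 2 * d + 2 by ring]
        module
  obtain ⟨c, hc, e⟩ := key
  intro h0
  rw [h0, map_zero] at e
  have := smul_eq_zero.1 e.symm
  simp [hc, mono] at this

/-- A zero of `P⁺` on the tower would cut the labels off at that `j` and leave only finitely many.
-/
lemma Pplus_ne_zero_of_infinite (h : ¬ FiniteDimensional ℂ (V l r)) :
    ∀ i, InTower l i → Pplus l r i ≠ 0 := by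
  intro i hi h0
  apply h
  obtain ⟨n, hn⟩ := hi
  have hfin : (labels l r).Finite := by
    refine (((Set.finite_Iic n).prod (Set.finite_Iic (⌊2 * i⌋.toNat))).image
      fun x : ℕ × ℕ => (|l| + (x.1 : ℚ), -(|l| + (x.1 : ℚ)) + (x.2 : ℚ))).subset ?_
    rintro ⟨j, m⟩ ⟨⟨k, hk⟩, hj, ⟨a, ha, hm⟩⟩
    have hji : j ≤ i := by
      by_contra hlt
      exact hj i ⟨n, hn⟩ (not_le.1 hlt) h0
    simp only at hk hj ha hm
    refine ⟨(k, a), ⟨?_, ?_⟩, ?_⟩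
    · have : (k : ℚ) ≤ n := by linarith
      exact_mod_cast this
    · have h1 : ((a : ℤ) : ℚ) ≤ 2 * i := by push_cast; linarith
      have := Int.le_floor.2 h1
      simp only [Set.mem_Iic]
      omega
    · simp only [← hk, ← ha]
  have := hfin.to_subtype
  infer_instance

end Intertwining


/-! ### The spin module `F` as binary forms -/

section FiniteDimensionalModule

/-- The embedding of `F_g` into the homogeneous polynomials of degree `2 g`, a polynomial being the
sequence of the coefficients of `x ^ (2 g - k) y ^ k`. -/
def polyEmb (g : ℚ) : F g →ₗ[ℂ] (ℤ →₀ ℂ) :=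
  Finsupp.linearCombination ℂ fun μ : Mset g =>
    ((sqrtFactorial ⌊g + μ.1⌋.toNat)⁻¹ * (sqrtFactorial ⌊g - μ.1⌋.toNat)⁻¹) •
      Finsupp.single ⌊g - μ.1⌋ (1 : ℂ)

variable {g : ℚ} {n : ℕ}

lemma exists_of_mem_Mset (hg : g = (n : ℚ) / 2) {μ : ℚ} (hμ : μ ∈ Mset g) :
    ∃ a b : ℕ, a + b = n ∧ μ = ((a : ℚ) - b) / 2 := by
  obtain ⟨a, ha, hle⟩ := hμ
  have : (a : ℚ) ≤ n := by linarith
  obtain ⟨b, hb⟩ := Nat.exists_eq_add_of_le (show a ≤ n by exact_mod_cast this)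
  have hb' : (n : ℚ) = a + b := by exact_mod_cast hb
  exact ⟨a, b, hb.symm, by rw [ha, hg, hb']; ring⟩

lemma mem_Mset (hg : g = (n : ℚ) / 2) {a b : ℕ} (h : a + b = n) {μ : ℚ}
    (hμ : μ = ((a : ℚ) - b) / 2) : μ ∈ Mset g := by
  have h' : (n : ℚ) = a + b := by exact_mod_cast h.symm
  have : (0 : ℚ) ≤ b := Nat.cast_nonneg b
  exact ⟨a, by rw [hμ, hg, h']; ring, by rw [hμ, hg, h']; linarith⟩

lemma polyEmb_single (hg : g = (n : ℚ) / 2) {a b : ℕ} (h : a + b = n) (μ : Mset g)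
    (hμ : μ.1 = ((a : ℚ) - b) / 2) :
    polyEmb g (Finsupp.single μ 1) =
      ((sqrtFactorial a)⁻¹ * (sqrtFactorial b)⁻¹) • Finsupp.single (b : ℤ) 1 := by
  have h' : (n : ℚ) = a + b := by exact_mod_cast h.symm
  have e1 : g + μ.1 = ((a : ℤ) : ℚ) := by rw [hμ, hg, h']; push_cast; ring
  have e2 : g - μ.1 = ((b : ℤ) : ℚ) := by rw [hμ, hg, h']; push_cast; ring
  rw [polyEmb, Finsupp.linearCombination_single, one_smul, e1, e2, Int.floor_intCast,
    Int.floor_intCast, Int.toNat_natCast, Int.toNat_natCast]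

lemma polyEmb_ketF (hg : g = (n : ℚ) / 2) {a b : ℕ} (h : a + b = n) {μ : ℚ}
    (hμ : μ = ((a : ℚ) - b) / 2) :
    polyEmb g (ketF g μ) =
      ((sqrtFactorial a)⁻¹ * (sqrtFactorial b)⁻¹) • Finsupp.single (b : ℤ) 1 := by
  rw [ketF, dif_pos (mem_Mset hg h hμ), polyEmb_single hg h _ hμ]

lemma polyEmb_injective (hg : g = (n : ℚ) / 2) : Function.Injective (polyEmb g) := by
  have hli : LinearIndependent ℂ fun μ : Mset g => Finsupp.single ⌊g - μ.1⌋ (1 : ℂ) := by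
    have := (Finsupp.basisSingleOne (R := ℂ) (ι := ℤ)).linearIndependent.comp
      (fun μ : Mset g => ⌊g - μ.1⌋) ?_
    · convert this using 2
      simp
    · rintro ⟨μ, hμ⟩ ⟨μ', hμ'⟩ e
      obtain ⟨a, b, h, hm⟩ := exists_of_mem_Mset hg hμ
      obtain ⟨a', b', h', hm'⟩ := exists_of_mem_Mset hg hμ'
      have hn : (n : ℚ) = a + b := by exact_mod_cast h.symm
      have hn' : (n : ℚ) = a' + b' := by exact_mod_cast h'.symm
      simp only at e
      rw [show g - μ = ((b : ℤ) : ℚ) by rw [hm, hg, hn]; push_cast; ring,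
        show g - μ' = ((b' : ℤ) : ℚ) by rw [hm', hg, hn']; push_cast; ring] at e
      simp only [Int.floor_intCast] at e
      have hb : b = b' := by omega
      have ha : a = a' := by omega
      exact Subtype.ext ((hm.trans (by rw [ha, hb])).trans hm'.symm)
  exact hli.units_smul fun μ => Units.mk0
    ((sqrtFactorial ⌊g + μ.1⌋.toNat)⁻¹ * (sqrtFactorial ⌊g - μ.1⌋.toNat)⁻¹)
    (mul_ne_zero (inv_ne_zero (sqrtFactorial_ne_zero _)) (inv_ne_zero (sqrtFactorial_ne_zero _)))

/-- A linear identity on `F_g` may be checked on the basis vectors. -/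
lemma F_ext (hg : g = (n : ℚ) / 2) {W : Type*} [AddCommGroup W] [Module ℂ W] {S T : F g →ₗ[ℂ] W}
    (h : ∀ a b : ℕ, a + b = n → ∀ μ : Mset g, μ.1 = ((a : ℚ) - b) / 2 →
      S (Finsupp.single μ 1) = T (Finsupp.single μ 1)) : S = T := by
  refine Finsupp.lhom_ext' fun μ => LinearMap.ext_ring ?_
  obtain ⟨a, b, hab, hμ⟩ := exists_of_mem_Mset hg μ.2
  exact h a b hab μ hμ

lemma opF_single (f : ℚ → F g) (μ : Mset g) : opF g f (Finsupp.single μ 1) = f μ.1 := by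
  rw [opF, Finsupp.linearCombination_single, one_smul]

lemma polyEmb_eq_zero (hg : g = (n : ℚ) / 2) (f : F g) {k : ℤ} (hk : k < 0 ∨ (n : ℤ) < k) :
    polyEmb g f k = 0 := by
  suffices Finsupp.lapply k ∘ₗ polyEmb g = 0 from LinearMap.congr_fun this f
  refine F_ext hg fun a b h μ hμ => ?_
  rw [LinearMap.comp_apply, polyEmb_single hg h μ hμ, Finsupp.lapply_apply, Finsupp.smul_apply,
    Finsupp.single_eq_of_ne (by omega)]
  simp

/-- This and the next two lemmas say that `J₀ = (x∂_x - y∂_y) / 2`, `J₊ = x∂_y`, `J₋ = y∂_x`, read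
on coefficients. The index counts powers of `y`, so `J₊` takes the coefficient at `k` from `k + 1`.
-/
lemma polyEmb_J0F (hg : g = (n : ℚ) / 2) (f : F g) (k : ℤ) :
    polyEmb g (J0F g f) k = ((n : ℂ) / 2 - k) * polyEmb g f k := by
  suffices Finsupp.lapply k ∘ₗ polyEmb g ∘ₗ J0F g =
      ((n : ℂ) / 2 - k) • (Finsupp.lapply k ∘ₗ polyEmb g) from LinearMap.congr_fun this f
  refine F_ext hg fun a b h μ hμ => ?_
  simp only [LinearMap.comp_apply, LinearMap.smul_apply, Finsupp.lapply_apply]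
  rw [J0F, opF_single, map_smul, polyEmb_single hg h μ hμ, polyEmb_ketF hg h hμ, hμ, ← h]
  simp only [Finsupp.smul_apply, Finsupp.single_apply]
  split_ifs with hk
  · rw [← hk]
    simp only [smul_eq_mul]
    push_cast
    ring
  · simp

lemma polyEmb_JpF (hg : g = (n : ℚ) / 2) (f : F g) (k : ℤ) :
    polyEmb g (JpmF g 1 f) k = ((k : ℂ) + 1) * polyEmb g f (k + 1) := by
  suffices Finsupp.lapply k ∘ₗ polyEmb g ∘ₗ JpmF g 1 =
      ((k : ℂ) + 1) • (Finsupp.lapply (k + 1) ∘ₗ polyEmb g) from LinearMap.congr_fun this f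
  refine F_ext hg fun a b h μ hμ => ?_
  have h' : (n : ℚ) = a + b := by exact_mod_cast h.symm
  simp only [LinearMap.comp_apply, LinearMap.smul_apply, Finsupp.lapply_apply]
  rw [JpmF, opF_single, map_smul, polyEmb_single hg h μ hμ,
    ladder_one_eq a b (by rw [hg, h']; push_cast; ring) (by rw [hμ]; push_cast; ring)]
  rcases b with _ | b
  · simp only [Finsupp.smul_apply, Finsupp.single_apply]
    split_ifs with hk
    · have : (k : ℂ) + 1 = 0 := by exact_mod_cast hk.symm
      simp [this]
    · simp
  · rw [polyEmb_ketF hg (a := a + 1) (b := b) (by omega) (by rw [hμ]; push_cast; ring)]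
    simp only [Finsupp.smul_apply, Finsupp.single_apply]
    push_cast
    by_cases hk : (b : ℤ) = k
    · rw [if_pos hk, if_pos (by omega), ← hk]
      simp only [smul_eq_mul, mul_one]
      push_cast
      rw [← sqrt_mul_inv_sqrtFactorial_succ a]
      linear_combination (Complex.sqrt (a + 1) * (sqrtFactorial (a + 1))⁻¹) *
        sqrt_mul_inv_sqrtFactorial b
    · rw [if_neg hk, if_neg (by omega)]
      simp

lemma polyEmb_JmF (hg : g = (n : ℚ) / 2) (f : F g) (k : ℤ) :
    polyEmb g (JpmF g (-1) f) k = ((n : ℂ) - k + 1) * polyEmb g f (k - 1) := by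
  suffices Finsupp.lapply k ∘ₗ polyEmb g ∘ₗ JpmF g (-1) =
      ((n : ℂ) - k + 1) • (Finsupp.lapply (k - 1) ∘ₗ polyEmb g) from LinearMap.congr_fun this f
  refine F_ext hg fun a b h μ hμ => ?_
  have h' : (n : ℚ) = a + b := by exact_mod_cast h.symm
  simp only [LinearMap.comp_apply, LinearMap.smul_apply, Finsupp.lapply_apply]
  rw [JpmF, opF_single, map_smul, polyEmb_single hg h μ hμ,
    ladder_neg_one_eq a b (by rw [hg, h']; push_cast; ring) (by rw [hμ]; push_cast; ring)]
  rcases a with _ | a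
  · simp only [Finsupp.smul_apply, Finsupp.single_apply]
    split_ifs with hk
    · have : (n : ℂ) - k + 1 = 0 := by exact_mod_cast (show (n : ℤ) - k + 1 = 0 by omega)
      simp [this]
    · simp
  · rw [polyEmb_ketF hg (a := a) (b := b + 1) (by omega) (by rw [hμ]; push_cast; ring)]
    simp only [Finsupp.smul_apply, Finsupp.single_apply]
    push_cast
    by_cases hk : (b : ℤ) + 1 = k
    · rw [if_pos hk, if_pos (by omega), ← hk, ← h]
      simp only [smul_eq_mul, mul_one]
      push_cast
      rw [← sqrt_mul_inv_sqrtFactorial_succ b]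
      linear_combination (Complex.sqrt (b + 1) * (sqrtFactorial (b + 1))⁻¹) *
        sqrt_mul_inv_sqrtFactorial a
    · rw [if_neg hk, if_neg (by omega)]
      simp

lemma casimir_F (hg : g = (n : ℚ) / 2) (f : F g) :
    J0F g (J0F g f) + (1 / 2 : ℂ) • (JpmF g 1 (JpmF g (-1) f) + JpmF g (-1) (JpmF g 1 f)) =
      ((n : ℂ) / 2 * (n / 2 + 1)) • f := by
  apply polyEmb_injective hg
  ext k
  simp only [map_add, map_smul, Finsupp.add_apply, Finsupp.smul_apply, polyEmb_J0F hg,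
    polyEmb_JpF hg, polyEmb_JmF hg, add_sub_cancel_right, sub_add_cancel, smul_eq_mul]
  push_cast
  ring

lemma K0F_apply (A : ℤ) (f : F g) : K0F A g f = (Complex.I * A) • J0F g f := by
  suffices K0F A g = (Complex.I * A) • J0F g from LinearMap.congr_fun this f
  refine Finsupp.lhom_ext' fun μ => LinearMap.ext_ring ?_
  simp only [LinearMap.comp_apply, Finsupp.lsingle_apply, LinearMap.smul_apply, K0F, J0F,
    opF_single, smul_smul]

lemma KpmF_apply (A s : ℤ) (f : F g) : KpmF A g s f = (Complex.I * A) • JpmF g s f := by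
  suffices KpmF A g s = (Complex.I * A) • JpmF g s from LinearMap.congr_fun this f
  refine Finsupp.lhom_ext' fun μ => LinearMap.ext_ring ?_
  simp only [LinearMap.comp_apply, Finsupp.lsingle_apply, LinearMap.smul_apply, KpmF, JpmF,
    opF_single, smul_smul]

end FiniteDimensionalModule

/-! ### The product module -/

section Product

variable {g : ℚ} {n : ℕ} {U : Type*} [AddCommGroup U] [Module ℂ U]

/-- The embedding of `F_g ⊗ U` into the `U`-valued sequences. -/
def productEmb (g : ℚ) (U : Type*) [AddCommGroup U] [Module ℂ U] : F g ⊗[ℂ] U →ₗ[ℂ] (ℤ → U) :=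
  Finsupp.lcoeFun ∘ₗ (TensorProduct.finsuppScalarLeft ℂ U ℤ).toLinearMap ∘ₗ
    LinearMap.rTensor U (polyEmb g)

@[simp] lemma productEmb_tmul (f : F g) (v : U) (k : ℤ) :
    productEmb g U (f ⊗ₜ v) k = polyEmb g f k • v := by
  simp [productEmb]

lemma productEmb_injective (hg : g = (n : ℚ) / 2) : Function.Injective (productEmb g U) := by
  have h := Module.Flat.rTensor_preserves_injective_linearMap (M := U) (polyEmb g)
    (polyEmb_injective hg)
  exact DFunLike.coe_injective.comp
    ((TensorProduct.finsuppScalarLeft ℂ U ℤ).injective.comp h)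

lemma productEmb_supported (hg : g = (n : ℚ) / 2) (w : F g ⊗[ℂ] U) :
    SupportedUpTo n (productEmb g U w) := by
  intro k hk
  induction w using TensorProduct.induction_on with
  | zero => simp
  | tmul f v => rw [productEmb_tmul, polyEmb_eq_zero hg f hk, zero_smul]
  | add w w' h h' => rw [map_add, Pi.add_apply, h, h', add_zero]

/-- Twice the scalar product of the generators of `F_g` with `(N₀, N_±)`. -/
def productCoupling (g : ℚ) (N0 Np Nm : Module.End ℂ U) : Module.End ℂ (F g ⊗[ℂ] U) :=
  (2 : ℂ) • TensorProduct.map (J0F g) N0 + TensorProduct.map (JpmF g 1) Nm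
    + TensorProduct.map (JpmF g (-1)) Np

lemma productEmb_productCoupling (hg : g = (n : ℚ) / 2) (N0 Np Nm : Module.End ℂ U)
    (w : F g ⊗[ℂ] U) :
    productEmb g U (productCoupling g N0 Np Nm w) =
      spinCoupling N0 Np Nm n (productEmb g U w) := by
  induction w using TensorProduct.induction_on with
  | zero => simp
  | add w w' h h' => rw [map_add, map_add, map_add, map_add, h, h']
  | tmul f v =>
    ext k
    simp only [productCoupling, spinCoupling, LinearMap.add_apply, LinearMap.smul_apply,
      TensorProduct.map_tmul, map_add, map_smul, Pi.add_apply, Pi.smul_apply, productEmb_tmul,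
      polyEmb_J0F hg, polyEmb_JpF hg, polyEmb_JmF hg, LinearMap.coe_mk, AddHom.coe_mk]
    module

/-- This supplies `xⁿ ⊗ v`: the highest vector of `F`, rescaled to have leading coefficient one. -/
lemma exists_productEmb_eq (hg : g = (n : ℚ) / 2) (v : U) :
    ∃ w : F g ⊗[ℂ] U, productEmb g U w 0 = v ∧ ∀ k ≠ 0, productEmb g U w k = 0 := by
  have e := polyEmb_ketF hg (a := n) (b := 0) (by omega) (μ := g) (by rw [hg]; simp)
  have hc : (sqrtFactorial n)⁻¹ * (sqrtFactorial 0)⁻¹ ≠ 0 :=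
    mul_ne_zero (inv_ne_zero (sqrtFactorial_ne_zero _)) (inv_ne_zero (sqrtFactorial_ne_zero _))
  refine ⟨(((sqrtFactorial n)⁻¹ * (sqrtFactorial 0)⁻¹)⁻¹ • ketF g g) ⊗ₜ v, ?_, fun k hk => ?_⟩
  · rw [productEmb_tmul, map_smul, e, smul_smul, inv_mul_cancel₀ hc]
    simp
  · rw [productEmb_tmul, map_smul, e, smul_smul, inv_mul_cancel₀ hc]
    simp [hk]

lemma onProduct_cartesian {W W' : Type*} [AddCommGroup W] [Module ℂ W] [AddCommGroup W']
    [Module ℂ W'] (X0 : Module.End ℂ W) (X : ℤ → Module.End ℂ W) (X0' : Module.End ℂ W')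
    (X' : ℤ → Module.End ℂ W') (a : Fin 3) :
    onProduct (cartesian X0 X a) (cartesian X0' X' a) =
      cartesian (onProduct X0 X0') (fun s => onProduct (X s) (X' s)) a := by
  refine TensorProduct.ext' fun f v => ?_
  fin_cases a
  · rfl
  all_goals
    simp only [cartesian, onProduct, Fin.mk_one, Fin.reduceFinMk, Matrix.cons_val_one,
      Matrix.cons_val, LinearMap.add_apply, LinearMap.sub_apply, LinearMap.smul_apply,
      LinearMap.id_apply, TensorProduct.map_tmul, TensorProduct.add_tmul, TensorProduct.tmul_add,
      TensorProduct.sub_tmul, TensorProduct.tmul_sub, ← TensorProduct.smul_tmul',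
      TensorProduct.tmul_smul]
    module

lemma sum_cartesian_mul {W : Type*} [AddCommGroup W] [Module ℂ W] (X0 Y0 : Module.End ℂ W)
    (X Y : ℤ → Module.End ℂ W) (v : W) :
    (∑ a, cartesian X0 X a * cartesian Y0 Y a) v =
      X0 (Y0 v) + (1 / 2 : ℂ) • (X 1 (Y (-1) v) + X (-1) (Y 1 v)) := by
  simp only [Fin.sum_univ_three, cartesian, Matrix.cons_val_zero, Matrix.cons_val_one,
    Matrix.cons_val, LinearMap.add_apply, Module.End.mul_apply, LinearMap.smul_apply,
    LinearMap.sub_apply, map_add, map_sub, map_smul]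
  have hI : (1 / (2 * Complex.I)) * (1 / (2 * Complex.I)) = -(1 / 4 : ℂ) := by
    rw [div_mul_div_comm, show 2 * Complex.I * (2 * Complex.I) = 4 * Complex.I ^ 2 by ring,
      Complex.I_sq]
    norm_num
  simp only [smul_add, smul_sub, smul_smul, hI]
  module

/-! ### The Casimirs of the product in terms of the chiral coupling -/

section Casimirs

variable {W W' : Type*} [AddCommGroup W] [Module ℂ W] [AddCommGroup W'] [Module ℂ W']
  {J0 : Module.End ℂ W} {J : ℤ → Module.End ℂ W} {K0 : Module.End ℂ W} {K : ℤ → Module.End ℂ W}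
  {J0' : Module.End ℂ W'} {J' : ℤ → Module.End ℂ W'} {K0' : Module.End ℂ W'}
  {K' : ℤ → Module.End ℂ W'} {c c₁ c₂ ε : ℂ}

/-- The product of the spin generators `J₀, J_±` with the chiral half of another representation. -/
def chiralCoupling (J0 : Module.End ℂ W) (J : ℤ → Module.End ℂ W) (J0' : Module.End ℂ W')
    (J' : ℤ → Module.End ℂ W') (K0' : Module.End ℂ W') (K' : ℤ → Module.End ℂ W') (ε : ℂ) :
    Module.End ℂ (W ⊗[ℂ] W') :=
  (2 : ℂ) • TensorProduct.map J0 ((1 / 2 : ℂ) • (J0' + ε • K0'))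
    + TensorProduct.map (J 1) ((1 / 2 : ℂ) • (J' (-1) + ε • K' (-1)))
    + TensorProduct.map (J (-1)) ((1 / 2 : ℂ) • (J' 1 + ε • K' 1))

/-- With `K = -εJ` on the first factor, the mixed terms of `J · K` are `J ⊗ (K' - εJ')`, and `K' -
εJ' = -ε (J' + εK')` because `ε² = -1`. The unmixed terms are scalars. -/
lemma casimir1_onProduct (hε : ε ^ 2 = -1)
    (hc : ∀ f, J0 (J0 f) + (1 / 2 : ℂ) • (J 1 (J (-1) f) + J (-1) (J 1 f)) = c • f)
    (hK0 : ∀ f, K0 f = (-ε) • J0 f) (hK : ∀ s f, K s f = (-ε) • J s f)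
    (h : ∀ v, LorentzRelations J0' (J' 1) (J' (-1)) K0' (K' 1) (K' (-1)) c₁ c₂ v) :
    casimir1 (fun a => onProduct (cartesian J0 J a) (cartesian J0' J' a))
        (fun a => onProduct (cartesian K0 K a) (cartesian K0' K' a)) =
      (-ε) • chiralCoupling J0 J J0' J' K0' K' ε + (-ε * c + c₁) • 1 := by
  refine TensorProduct.ext' fun f v => ?_
  have hAI : ∀ w : W ⊗[ℂ] W', ε • ε • w = -w := by
    intro w
    rw [smul_smul, ← sq, hε, neg_one_smul]
  have hF := congrArg (fun x => x ⊗ₜ[ℂ] v) (hc f)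
  have hV := congrArg (fun x => f ⊗ₜ[ℂ] x) (h v).casimir₁
  -- The Casimir in `LorentzRelations` is normal ordered; this commutator converts it to the
  -- symmetric form of `sum_cartesian_mul`.
  have e4 := congrArg (fun x => f ⊗ₜ[ℂ] x) (h v).jp_km
  have e1 := hAI (J0 f ⊗ₜ K0' v)
  have e2 := hAI (J 1 f ⊗ₜ K' (-1) v)
  have e3 := hAI (J (-1) f ⊗ₜ K' 1 v)
  simp only [casimir1, onProduct_cartesian]
  rw [sum_cartesian_mul]
  simp only [onProduct, chiralCoupling, LinearMap.add_apply, LinearMap.smul_apply,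
    TensorProduct.map_tmul, LinearMap.id_apply, map_add, hK0, hK, map_smul,
    TensorProduct.tmul_add, TensorProduct.add_tmul, TensorProduct.tmul_smul,
    ← TensorProduct.smul_tmul', smul_add, Module.End.one_apply] at hF hV e4 ⊢
  linear_combination (norm := module) (-ε) • hF + hV + (1 / 2 : ℂ) • e4 + e1 + (1 / 2 : ℂ) • e2
    + (1 / 2 : ℂ) • e3

/-- The mixed terms of `J² - K²` are `2 J ⊗ J' + 2ε J ⊗ K'`, again the coupling to `J' + εK'`. On
the first factor `-K² = J²`, hence the scalar `2c`. -/
lemma casimir2_onProduct (hε : ε ^ 2 = -1)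
    (hc : ∀ f, J0 (J0 f) + (1 / 2 : ℂ) • (J 1 (J (-1) f) + J (-1) (J 1 f)) = c • f)
    (hK0 : ∀ f, K0 f = (-ε) • J0 f) (hK : ∀ s f, K s f = (-ε) • J s f)
    (h : ∀ v, LorentzRelations J0' (J' 1) (J' (-1)) K0' (K' 1) (K' (-1)) c₁ c₂ v) :
    casimir2 (fun a => onProduct (cartesian J0 J a) (cartesian J0' J' a))
        (fun a => onProduct (cartesian K0 K a) (cartesian K0' K' a)) =
      (2 : ℂ) • chiralCoupling J0 J J0' J' K0' K' ε + (2 * c + c₂) • 1 := by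
  refine TensorProduct.ext' fun f v => ?_
  have hAI : ∀ w : W ⊗[ℂ] W', ε • ε • w = -w := by
    intro w
    rw [smul_smul, ← sq, hε, neg_one_smul]
  have hF := congrArg (fun x => x ⊗ₜ[ℂ] v) (hc f)
  have hV := congrArg (fun x => f ⊗ₜ[ℂ] x) (h v).casimir₂
  have e4 := congrArg (fun x => f ⊗ₜ[ℂ] x) (h v).jp_jm
  have e5 := congrArg (fun x => f ⊗ₜ[ℂ] x) (h v).kp_km
  have e1 := hAI (J0 (J0 f) ⊗ₜ v)
  have e2 := hAI (J 1 (J (-1) f) ⊗ₜ v)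
  have e3 := hAI (J (-1) (J 1 f) ⊗ₜ v)
  simp only [casimir2, onProduct_cartesian]
  rw [LinearMap.sub_apply, sum_cartesian_mul, sum_cartesian_mul]
  simp only [onProduct, chiralCoupling, LinearMap.add_apply, LinearMap.smul_apply,
    TensorProduct.map_tmul, LinearMap.id_apply, map_add, hK0, hK, map_smul,
    TensorProduct.tmul_add, TensorProduct.add_tmul, TensorProduct.tmul_smul,
    TensorProduct.tmul_sub,
    ← TensorProduct.smul_tmul', smul_add, Module.End.one_apply] at hF hV e4 e5 ⊢
  linear_combination (norm := module) (2 : ℂ) • hF + hV + (1 / 2 : ℂ) • e4 - (1 / 2 : ℂ) • e5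
    - e1 - (1 / 2 : ℂ) • e2 - (1 / 2 : ℂ) • e3

end Casimirs

lemma IsDiagonalisable.of_smul_add {W : Type*} [AddCommGroup W] [Module ℂ W] {S T : Module.End ℂ W}
    {α β : ℂ} (hα : α ≠ 0) (hS : S = α • T + β • 1) (h : IsDiagonalisable S) :
    IsDiagonalisable T := by
  obtain ⟨s, b, hb⟩ := h
  refine ⟨s, b, fun i => ?_⟩
  obtain ⟨c, hc⟩ := hb i
  refine ⟨α⁻¹ * (c - β), ?_⟩
  rw [hS] at hc
  simp only [LinearMap.add_apply, LinearMap.smul_apply, Module.End.one_apply] at hc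
  rw [mul_smul, sub_smul, ← hc, add_sub_cancel_right, inv_smul_smul₀ hα]

variable {l : ℚ} {r : ℂ} {L : ℕ}

lemma not_isDiagonalisable_coupling (hL : |l| = (L : ℚ) / 2)
    (hP : ∀ i, InTower l i → Pplus l r i ≠ 0) (hg : g = (n : ℚ) / 2) {ε : ℂ} (hε : ε ^ 2 = -1)
    {m : ℤ} (hm : (m : ℂ) ^ 2 = l ^ 2 + r ^ 2 - 1 + 2 * ε * (Complex.I * l * r) + 1)
    (h1 : -(n : ℤ) < m) (h2 : m < n) :
    ¬ IsDiagonalisable (chiralCoupling (J0F g) (JpmF g) (J0V l r) (JpmV l r) (K0V l r)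
      (KpmV l r) ε) := by
  obtain ⟨w, hw0, hw⟩ := exists_productEmb_eq hg (ket l r |l| |l|)
  have hε0 : ε ≠ 0 := by
    rintro rfl
    norm_num at hε
  exact not_isDiagonalisable_of_spinCoupling
    (isSl2Rep_of_lorentzRelations hε hm (lorentzRelations_V hL hP)) h1 h2
    (pow_chiral_raise_ne_zero hL hP hε0) _ (productEmb g (V l r)) (productEmb_injective hg)
    (productEmb_supported hg) (productEmb_productCoupling hg _ _ _) w hw0 hw

end Product

end Lorentz

end

/-! ### The theorem -/

theorem mainTheorem3 (A : ℤ) (hA : A = 1 ∨ A = -1)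
    (γ : ℚ) (hγ : ∃ n : ℕ, 1 ≤ n ∧ γ = (n : ℚ) / 2)
    (lam : ℚ) (hlam : ∃ n : ℤ, lam = (n : ℚ) / 2) (ρ : ℂ)
    (hinf : ¬ FiniteDimensional ℂ (Lorentz.V lam ρ))
    (hρ : ∃ n : ℤ, -(2 * γ) < n ∧ (n : ℚ) < 2 * γ ∧ ρ + A * lam = n) :
    ¬ Lorentz.IsDiagonalisable (Lorentz.casimir1Prod A γ lam ρ) ∧
    ¬ Lorentz.IsDiagonalisable (Lorentz.casimir2Prod A γ lam ρ) := by
  obtain ⟨n, -, hg⟩ := hγ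
  obtain ⟨N, hN⟩ := hlam
  obtain ⟨m, h1, h2, hm⟩ := hρ
  have hL : |lam| = ((N.natAbs : ℕ) : ℚ) / 2 := by
    rw [hN, abs_div, abs_of_pos (two_pos : (0 : ℚ) < 2), Nat.cast_natAbs, Int.cast_abs]
  have hP := Lorentz.Pplus_ne_zero_of_infinite hinf
  have hA2 : (A : ℂ) ^ 2 = 1 := by rcases hA with rfl | rfl <;> norm_num
  -- The choice `ε = -iA` selects the chiral half acting on `F^A_γ`, where `K = iAJ = -εJ`.
  have hε : (-(Complex.I * A)) ^ 2 = -1 := by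
    rw [neg_sq, mul_pow, hA2, Complex.I_sq]; norm_num
  have hε0 : -(-(Complex.I * A)) ≠ 0 := by
    intro h
    rw [neg_eq_zero.1 h] at hε
    norm_num at hε
  -- For `C₁ = iλρ` and `C₂ = λ² + ρ² - 1` the number `C₂ + 2ε C₁ + 1` is `(ρ + Aλ)²`, so `m = ρ +
  -- Aλ` serves as `ν`.
  have hT := Lorentz.not_isDiagonalisable_coupling hL hP hg hε (m := m)
    (by
      rw [← hm]
      linear_combination (lam : ℂ) ^ 2 * hA2 + 2 * A * lam * ρ * Complex.I_sq)
    (by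
      have : (-(n : ℤ) : ℚ) < m := by rw [hg] at h1; push_cast; linarith
      exact_mod_cast this)
    (by
      have : (m : ℚ) < n := by rw [hg] at h2; linarith
      exact_mod_cast this)
  have hK0 : ∀ f, Lorentz.K0F A γ f = (-(-(Complex.I * A))) • Lorentz.J0F γ f := fun f => by
    rw [neg_neg, Lorentz.K0F_apply]
  have hK : ∀ s f, Lorentz.KpmF A γ s f = (-(-(Complex.I * A))) • Lorentz.JpmF γ s f :=
    fun s f => by rw [neg_neg, Lorentz.KpmF_apply]
  exact ⟨fun h => hT (h.of_smul_add hε0 (Lorentz.casimir1_onProduct hε (Lorentz.casimir_F hg) hK0 hK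
      (Lorentz.lorentzRelations_V hL hP))),
    fun h => hT (h.of_smul_add two_ne_zero (Lorentz.casimir2_onProduct hε (Lorentz.casimir_F hg) hK0
      hK (Lorentz.lorentzRelations_V hL hP)))⟩
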